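/- Let $m\in\mathbb{Z}_{\ge 0}$. Let $\mathbf{Web}_{\mathbb C}$ be the web category of $O(m)$ at $q=1$: the pivotal $\mathbb{C}$-linear monoidal category generated by self-dual objects $n\in\mathbb{Z}_{\ge 0}$ ($0$ being the unit, so strands labelled $0$ may be erased) and by trivalent vertices $1\otimes k\to k+1$ and $k\otimes 1\to k+1$, together with their rotations by caps and cups, modulo $\mathrm{id}_k=0$ for $k>m$ and the following relations: (a) a circle labelled $1$ equals $m$; (b) a strand labelled $2$ which splits into two strands labelled $1$ that are then joined by a cap is $0$; (c) a strand labelled $k$ which splits into $1\otimes(k-1)$ and merges again equals $k$ times the strand; (d) the two ways of merging $1\otimes k\otimes 1$ into $k+2$ agree; (e) for $k\ge 1$, the web $k\otimes k\to 1\otimes 1$ with a horizontal edge labelled $k+1$ equals the web $k\otimes k\to 1\otimes 1$ with a horizontal edge labelled $k-1$ followed by merging its two outputs into $2$ and splitting them again, minus the web with a horizontal edge labelled $k-1$, plus the cap on $k\otimes k$ followed by the cup of $1\otimes 1$. Let $\mathbf{StdWeb}_{\mathbb C}$ be the full monoidal subcategory of $\mathbf{Web}_{\mathbb C}$ generated by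 the object $1$. Let $\mathcal{B}(m)$ be the Brauer category over $\mathbb{C}$ with parameter $m$ and generating object $\bullet$, and let $\eta:\mathcal{B}(m)\to\mathbf{StdWeb}_{\mathbb C}$ be the $\mathbb{C}$-linear monoidal functor with $\bullet\mapsto 1$ which sends cap and cup to cap and cup and the crossing to $\mathrm{id}_{1\otimes 1}$ minus the web merging $1\otimes 1$ into $2$ and splitting it again. For $k\ge 0$ let $S_k$ act on $\bullet^{\otimes k}$ in $\mathcal{B}(m)$ by permuting strands, and let $a_k=\frac{1}{k!}\sum_{w\in S_k}(-1)^{\ell(w)}w\in\mathrm{End}_{\mathcal{B}(m)}(\bullet^{\otimes k})$ be the antisymmetrizer. Then for every $k\in\mathbb{Z}_{\ge 0}$, writing $I_k\in\mathrm{End}(1^{\otimes k})$ for the web which merges $k$ strands labelled $1$, one at a time from the left, into a strand labelled $k$ and then splits it back by the mirror image of this web, one has in $\mathbf{StdWeb}_{\mathbb C}$ $$\sum_{w\in S_k}(-1)^{\ell(w)}\,\eta(w)=I_k,\qquad\text{equivalently}\qquad \eta(a_k)=\frac{1}{k!}\,I_k .$$ In particular $\eta(a_{m+1})=0$, since strands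 labelled $m+1$ vanish. -/

import Mathlib

open CategoryTheory MonoidalCategory

namespace OWeb

/-- Non-associative words in the letters `O`: the objects of a freely generated monoidal
category. -/
inductive Word (O : Type) : Type
  | unit : Word O
  | of (o : O) : Word O
  | tensor (x y : Word O) : Word O

/-- Formal `ℂ`-linear monoidal expressions in generating morphisms `G`. -/
inductive Term {O : Type} (G : Word O → Word O → Type) : Word O → Word O → Type
  | gen {x y : Word O} (g : G x y) : Term G x y
  | ident (x : Word O) : Term G x x
  | comp {x y z : Word O} (f : Term G x y) (g : Term G y z) : Term G x z
  | whiskerLeft (x : Word O) {y z : Word O} (f : Term G y z) : Term G (x.tensor y) (x.tensor z)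
  | whiskerRight {x y : Word O} (f : Term G x y) (z : Word O) : Term G (x.tensor z) (y.tensor z)
  | assocHom (x y z : Word O) : Term G ((x.tensor y).tensor z) (x.tensor (y.tensor z))
  | assocInv (x y z : Word O) : Term G (x.tensor (y.tensor z)) ((x.tensor y).tensor z)
  | leftHom (x : Word O) : Term G (Word.unit.tensor x) x
  | leftInv (x : Word O) : Term G x (Word.unit.tensor x)
  | rightHom (x : Word O) : Term G (x.tensor Word.unit) x
  | rightInv (x : Word O) : Term G x (x.tensor Word.unit)
  | zero (x y : Word O) : Term G x y
  | add {x y : Word O} (f g : Term G x y) : Term G x y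
  | smul {x y : Word O} (c : ℂ) (f : Term G x y) : Term G x y

/-- Generators and relations for a `ℂ`-linear monoidal category. -/
structure Presentation where
  /-- generating objects -/
  O : Type
  /-- generating morphisms -/
  G : Word O → Word O → Type
  /-- relations imposed between morphisms -/
  rel : ∀ {x y : Word O}, Term G x y → Term G x y → Prop

open Term in
/-- The congruence on expressions generated by the axioms of a `ℂ`-linear monoidal category and
by the relations `R`. -/
inductive Eqv {O : Type} {G : Word O → Word O → Type}
    (R : ∀ {x y : Word O}, Term G x y → Term G x y → Prop) :
    ∀ {x y : Word O}, Term G x y → Term G x y → Prop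
  | rel {x y : Word O} {f g : Term G x y} : R f g → Eqv R f g
  | refl {x y : Word O} (f : Term G x y) : Eqv R f f
  | symm {x y : Word O} {f g : Term G x y} : Eqv R f g → Eqv R g f
  | trans {x y : Word O} {f g h : Term G x y} : Eqv R f g → Eqv R g h → Eqv R f h
  -- congruence
  | comp_congr {x y z : Word O} {f f' : Term G x y} {g g' : Term G y z} :
      Eqv R f f' → Eqv R g g' → Eqv R (comp f g) (comp f' g')
  | whiskerLeft_congr (x : Word O) {y z : Word O} {f f' : Term G y z} :
      Eqv R f f' → Eqv R (whiskerLeft x f) (whiskerLeft x f')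
  | whiskerRight_congr {x y : Word O} {f f' : Term G x y} (z : Word O) :
      Eqv R f f' → Eqv R (whiskerRight f z) (whiskerRight f' z)
  | add_congr {x y : Word O} {f f' g g' : Term G x y} :
      Eqv R f f' → Eqv R g g' → Eqv R (add f g) (add f' g')
  | smul_congr {x y : Word O} (c : ℂ) {f f' : Term G x y} :
      Eqv R f f' → Eqv R (smul c f) (smul c f')
  -- category
  | id_comp {x y : Word O} (f : Term G x y) : Eqv R (comp (ident x) f) f
  | comp_id {x y : Word O} (f : Term G x y) : Eqv R (comp f (ident y)) f
  | comp_assoc {w x y z : Word O} (f : Term G w x) (g : Term G x y) (h : Term G y z) :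
      Eqv R (comp (comp f g) h) (comp f (comp g h))
  -- monoidal category
  | whiskerLeft_id (x y : Word O) : Eqv R (whiskerLeft x (ident y)) (ident (x.tensor y))
  | whiskerLeft_comp (w : Word O) {x y z : Word O} (f : Term G x y) (g : Term G y z) :
      Eqv R (whiskerLeft w (comp f g)) (comp (whiskerLeft w f) (whiskerLeft w g))
  | id_whiskerLeft {x y : Word O} (f : Term G x y) :
      Eqv R (whiskerLeft Word.unit f) (comp (leftHom x) (comp f (leftInv y)))
  | tensor_whiskerLeft (x y : Word O) {z z' : Word O} (f : Term G z z') :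
      Eqv R (whiskerLeft (x.tensor y) f)
        (comp (assocHom x y z) (comp (whiskerLeft x (whiskerLeft y f)) (assocInv x y z')))
  | id_whiskerRight (x y : Word O) : Eqv R (whiskerRight (ident x) y) (ident (x.tensor y))
  | comp_whiskerRight {x y z : Word O} (f : Term G x y) (g : Term G y z) (w : Word O) :
      Eqv R (whiskerRight (comp f g) w) (comp (whiskerRight f w) (whiskerRight g w))
  | whiskerRight_id {x y : Word O} (f : Term G x y) :
      Eqv R (whiskerRight f Word.unit) (comp (rightHom x) (comp f (rightInv y)))
  | whiskerRight_tensor {x x' : Word O} (f : Term G x x') (y z : Word O) :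
      Eqv R (whiskerRight f (y.tensor z))
        (comp (assocInv x y z) (comp (whiskerRight (whiskerRight f y) z) (assocHom x' y z)))
  | whisker_assoc (x : Word O) {y y' : Word O} (f : Term G y y') (z : Word O) :
      Eqv R (whiskerRight (whiskerLeft x f) z)
        (comp (assocHom x y z) (comp (whiskerLeft x (whiskerRight f z)) (assocInv x y' z)))
  | whisker_exchange {w x y z : Word O} (f : Term G w x) (g : Term G y z) :
      Eqv R (comp (whiskerLeft w g) (whiskerRight f z))
        (comp (whiskerRight f y) (whiskerLeft x g))
  | assoc_hom_inv (x y z : Word O) : Eqv R (comp (assocHom x y z) (assocInv x y z)) (ident _)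
  | assoc_inv_hom (x y z : Word O) : Eqv R (comp (assocInv x y z) (assocHom x y z)) (ident _)
  | left_hom_inv (x : Word O) : Eqv R (comp (leftHom x) (leftInv x)) (ident _)
  | left_inv_hom (x : Word O) : Eqv R (comp (leftInv x) (leftHom x)) (ident _)
  | right_hom_inv (x : Word O) : Eqv R (comp (rightHom x) (rightInv x)) (ident _)
  | right_inv_hom (x : Word O) : Eqv R (comp (rightInv x) (rightHom x)) (ident _)
  | pentagon (w x y z : Word O) :
      Eqv R (comp (whiskerRight (assocHom w x y) z)
          (comp (assocHom w (x.tensor y) z) (whiskerLeft w (assocHom x y z))))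
        (comp (assocHom (w.tensor x) y z) (assocHom w x (y.tensor z)))
  | triangle (x y : Word O) :
      Eqv R (comp (assocHom x Word.unit y) (whiskerLeft x (leftHom y)))
        (whiskerRight (rightHom x) y)
  -- linear structure on morphisms
  | add_assoc {x y : Word O} (f g h : Term G x y) : Eqv R (add (add f g) h) (add f (add g h))
  | add_comm {x y : Word O} (f g : Term G x y) : Eqv R (add f g) (add g f)
  | zero_add {x y : Word O} (f : Term G x y) : Eqv R (add (zero x y) f) f
  | smul_add {x y : Word O} (c : ℂ) (f g : Term G x y) :
      Eqv R (smul c (add f g)) (add (smul c f) (smul c g))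
  | add_smul {x y : Word O} (c d : ℂ) (f : Term G x y) :
      Eqv R (smul (c + d) f) (add (smul c f) (smul d f))
  | mul_smul {x y : Word O} (c d : ℂ) (f : Term G x y) :
      Eqv R (smul (c * d) f) (smul c (smul d f))
  | one_smul {x y : Word O} (f : Term G x y) : Eqv R (smul 1 f) f
  | zero_smul {x y : Word O} (f : Term G x y) : Eqv R (smul 0 f) (zero x y)
  -- bilinearity
  | add_comp {x y z : Word O} (f f' : Term G x y) (g : Term G y z) :
      Eqv R (comp (add f f') g) (add (comp f g) (comp f' g))
  | comp_add {x y z : Word O} (f : Term G x y) (g g' : Term G y z) :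
      Eqv R (comp f (add g g')) (add (comp f g) (comp f g'))
  | smul_comp {x y z : Word O} (c : ℂ) (f : Term G x y) (g : Term G y z) :
      Eqv R (comp (smul c f) g) (smul c (comp f g))
  | comp_smul {x y z : Word O} (c : ℂ) (f : Term G x y) (g : Term G y z) :
      Eqv R (comp f (smul c g)) (smul c (comp f g))
  | whiskerLeft_add (x : Word O) {y z : Word O} (f g : Term G y z) :
      Eqv R (whiskerLeft x (add f g)) (add (whiskerLeft x f) (whiskerLeft x g))
  | whiskerLeft_smul (x : Word O) {y z : Word O} (c : ℂ) (f : Term G y z) :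
      Eqv R (whiskerLeft x (smul c f)) (smul c (whiskerLeft x f))
  | add_whiskerRight {x y : Word O} (f g : Term G x y) (z : Word O) :
      Eqv R (whiskerRight (add f g) z) (add (whiskerRight f z) (whiskerRight g z))
  | smul_whiskerRight {x y : Word O} (c : ℂ) (f : Term G x y) (z : Word O) :
      Eqv R (whiskerRight (smul c f) z) (smul c (whiskerRight f z))

/-- The `ℂ`-linear monoidal category with the given presentation; its objects are the words in
the generating objects. -/
structure Presented (P : Presentation) : Type where
  /-- the object given by a word -/
  ofWord ::
  /-- the underlying word -/
  word : Word P.O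

namespace Presented

variable (P : Presentation)

/-- Expressions modulo the congruence. -/
def homSetoid (x y : Word P.O) : Setoid (Term P.G x y) where
  r := Eqv P.rel
  iseqv := ⟨Eqv.refl, Eqv.symm, Eqv.trans⟩

/-- Morphisms of the presented category. -/
def Mor (x y : Word P.O) : Type := Quotient (homSetoid P x y)

variable {P}

/-- The class of an expression. -/
def cls {x y : Word P.O} (f : Term P.G x y) : Mor P x y := Quotient.mk (homSetoid P x y) f

theorem cls_eq {x y : Word P.O} {f g : Term P.G x y} (h : Eqv P.rel f g) : cls f = cls g :=
  Quotient.sound h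

theorem exact {x y : Word P.O} {f g : Term P.G x y} (h : cls f = cls g) : Eqv P.rel f g :=
  Quotient.exact h

theorem cls_ind {x y : Word P.O} {p : Mor P x y → Prop} (h : ∀ f, p (cls f)) (a : Mor P x y) : p a :=
  Quotient.ind h a

instance instCategory : Category (Presented P) where
  Hom x y := Mor P x.word y.word
  id x := cls (Term.ident x.word)
  comp f g := Quotient.map₂ Term.comp (fun _ _ h _ _ h' => Eqv.comp_congr h h') f g
  id_comp f := by induction f using Quotient.ind; exact cls_eq (Eqv.id_comp _)
  comp_id f := by induction f using Quotient.ind; exact cls_eq (Eqv.comp_id _)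
  assoc f g h := by
    induction f using Quotient.ind
    induction g using Quotient.ind
    induction h using Quotient.ind
    exact cls_eq (Eqv.comp_assoc _ _ _)

instance instAdd (X Y : Presented P) : Add (X ⟶ Y) where
  add f g := Quotient.map₂ Term.add (fun _ _ h _ _ h' => Eqv.add_congr h h') f g

instance instZero (X Y : Presented P) : Zero (X ⟶ Y) where
  zero := cls (Term.zero _ _)

instance instNeg (X Y : Presented P) : Neg (X ⟶ Y) where
  neg f := Quotient.map (Term.smul (-1)) (fun _ _ h => Eqv.smul_congr _ h) f

instance instAddCommGroup (X Y : Presented P) : AddCommGroup (X ⟶ Y) where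
  nsmul := nsmulRec
  zsmul := zsmulRec
  add_assoc f g h := by
    induction f using Quotient.ind
    induction g using Quotient.ind
    induction h using Quotient.ind
    exact cls_eq (Eqv.add_assoc _ _ _)
  add_comm f g := by
    induction f using Quotient.ind
    induction g using Quotient.ind
    exact cls_eq (Eqv.add_comm _ _)
  zero_add f := by
    induction f using Quotient.ind
    exact cls_eq (Eqv.zero_add _)
  add_zero f := by
    induction f using Quotient.ind
    exact cls_eq ((Eqv.add_comm _ _).trans (Eqv.zero_add _))
  neg_add_cancel f := by
    induction f using Quotient.ind with | _ f
    have h : Eqv P.rel (Term.add (Term.smul (-1) f) f) (Term.zero _ _) := by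
      refine (Eqv.add_congr (Eqv.refl _) (Eqv.one_smul f).symm).trans ?_
      refine (Eqv.add_smul (-1) 1 f).symm.trans ?_
      rw [neg_add_cancel]
      exact Eqv.zero_smul f
    exact cls_eq h

instance instModule (X Y : Presented P) : Module ℂ (X ⟶ Y) where
  smul c f := Quotient.map (Term.smul c) (fun _ _ h => Eqv.smul_congr _ h) f
  one_smul f := by induction f using Quotient.ind; exact cls_eq (Eqv.one_smul _)
  mul_smul c d f := by induction f using Quotient.ind; exact cls_eq (Eqv.mul_smul _ _ _)
  smul_zero c := by
    refine cls_eq (P := P) ((Eqv.smul_congr c (Eqv.zero_smul (Term.zero _ _)).symm).trans ?_)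
    refine (Eqv.mul_smul _ _ _).symm.trans ?_
    rw [mul_zero]
    exact Eqv.zero_smul _
  smul_add c f g := by
    induction f using Quotient.ind
    induction g using Quotient.ind
    exact cls_eq (Eqv.smul_add _ _ _)
  add_smul c d f := by induction f using Quotient.ind; exact cls_eq (Eqv.add_smul _ _ _)
  zero_smul f := by induction f using Quotient.ind; exact cls_eq (Eqv.zero_smul _)

instance instPreadditive : Preadditive (Presented P) where
  add_comp _ _ _ f f' g := by
    induction f using Quotient.ind
    induction f' using Quotient.ind
    induction g using Quotient.ind
    exact cls_eq (Eqv.add_comp _ _ _)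
  comp_add _ _ _ f g g' := by
    induction f using Quotient.ind
    induction g using Quotient.ind
    induction g' using Quotient.ind
    exact cls_eq (Eqv.comp_add _ _ _)

instance instLinear : Linear ℂ (Presented P) where
  smul_comp _ _ _ c f g := by
    induction f using Quotient.ind
    induction g using Quotient.ind
    exact cls_eq (Eqv.smul_comp _ _ _)
  comp_smul _ _ _ f c g := by
    induction f using Quotient.ind
    induction g using Quotient.ind
    exact cls_eq (Eqv.comp_smul _ _ _)

instance instMonoidalCategoryStruct : MonoidalCategoryStruct (Presented P) where
  tensorObj X Y := ⟨X.word.tensor Y.word⟩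
  tensorUnit := ⟨Word.unit⟩
  whiskerLeft X _ _ f :=
    Quotient.map (Term.whiskerLeft X.word) (fun _ _ h => Eqv.whiskerLeft_congr _ h) f
  whiskerRight f Y :=
    Quotient.map (Term.whiskerRight · Y.word) (fun _ _ h => Eqv.whiskerRight_congr _ h) f
  associator _ _ _ :=
    ⟨cls (Term.assocHom _ _ _), cls (Term.assocInv _ _ _), cls_eq (Eqv.assoc_hom_inv _ _ _),
      cls_eq (Eqv.assoc_inv_hom _ _ _)⟩
  leftUnitor _ :=
    ⟨cls (Term.leftHom _), cls (Term.leftInv _), cls_eq (Eqv.left_hom_inv _),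
      cls_eq (Eqv.left_inv_hom _)⟩
  rightUnitor _ :=
    ⟨cls (Term.rightHom _), cls (Term.rightInv _), cls_eq (Eqv.right_hom_inv _),
      cls_eq (Eqv.right_inv_hom _)⟩
  tensorHom {_ Y₁ X₂ _} f g :=
    Quotient.map₂ (fun f g => Term.comp (Term.whiskerRight f X₂.word) (Term.whiskerLeft Y₁.word g))
      (fun _ _ h _ _ h' => Eqv.comp_congr (Eqv.whiskerRight_congr _ h)
        (Eqv.whiskerLeft_congr _ h')) f g

section lemmas

variable {U V W X Y Z : Presented P}

theorem whiskerLeft_id' (X Y : Presented P) : X ◁ 𝟙 Y = 𝟙 (X ⊗ Y) := cls_eq (Eqv.whiskerLeft_id _ _)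

theorem id_whiskerRight' (X Y : Presented P) : 𝟙 X ▷ Y = 𝟙 (X ⊗ Y) :=
  cls_eq (Eqv.id_whiskerRight _ _)

theorem whiskerLeft_comp' (W : Presented P) (f : X ⟶ Y) (g : Y ⟶ Z) :
    W ◁ (f ≫ g) = W ◁ f ≫ W ◁ g := by
  induction f using Quotient.ind
  induction g using Quotient.ind
  exact cls_eq (Eqv.whiskerLeft_comp _ _ _)

theorem comp_whiskerRight' (f : X ⟶ Y) (g : Y ⟶ Z) (W : Presented P) :
    (f ≫ g) ▷ W = f ▷ W ≫ g ▷ W := by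
  induction f using Quotient.ind
  induction g using Quotient.ind
  exact cls_eq (Eqv.comp_whiskerRight _ _ _)

theorem tensorHom_def'' (f : U ⟶ V) (g : X ⟶ Y) : f ⊗ₘ g = f ▷ X ≫ V ◁ g := by
  induction f using Quotient.ind
  induction g using Quotient.ind
  rfl

theorem id_whiskerLeft' (f : X ⟶ Y) : 𝟙_ (Presented P) ◁ f = (λ_ X).hom ≫ f ≫ (λ_ Y).inv := by
  induction f using Quotient.ind
  exact cls_eq (Eqv.id_whiskerLeft _)

theorem whiskerRight_id' (f : X ⟶ Y) : f ▷ 𝟙_ (Presented P) = (ρ_ X).hom ≫ f ≫ (ρ_ Y).inv := by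
  induction f using Quotient.ind
  exact cls_eq (Eqv.whiskerRight_id _)

theorem tensor_whiskerLeft' (X Y : Presented P) (f : Z ⟶ W) :
    (X ⊗ Y) ◁ f = (α_ X Y Z).hom ≫ X ◁ Y ◁ f ≫ (α_ X Y W).inv := by
  induction f using Quotient.ind
  exact cls_eq (Eqv.tensor_whiskerLeft _ _ _)

theorem whiskerRight_tensor' (f : X ⟶ W) (Y Z : Presented P) :
    f ▷ (Y ⊗ Z) = (α_ X Y Z).inv ≫ f ▷ Y ▷ Z ≫ (α_ W Y Z).hom := by
  induction f using Quotient.ind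
  exact cls_eq (Eqv.whiskerRight_tensor _ _ _)

theorem whisker_assoc' (X : Presented P) (f : Y ⟶ W) (Z : Presented P) :
    (X ◁ f) ▷ Z = (α_ X Y Z).hom ≫ X ◁ f ▷ Z ≫ (α_ X W Z).inv := by
  induction f using Quotient.ind
  exact cls_eq (Eqv.whisker_assoc _ _ _)

theorem whisker_exchange' (f : W ⟶ X) (g : Y ⟶ Z) : W ◁ g ≫ f ▷ Z = f ▷ Y ≫ X ◁ g := by
  induction f using Quotient.ind
  induction g using Quotient.ind
  exact cls_eq (Eqv.whisker_exchange _ _)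

end lemmas

instance instMonoidalCategory : MonoidalCategory (Presented P) where
  tensorHom_def f g := tensorHom_def'' f g
  id_tensorHom_id X Y := by
    rw [tensorHom_def'', whiskerLeft_id', id_whiskerRight', Category.id_comp]
  tensorHom_comp_tensorHom f₁ f₂ g₁ g₂ := by
    simp only [tensorHom_def'', whiskerLeft_comp', comp_whiskerRight', Category.assoc]
    rw [← Category.assoc (_ ◁ f₂), whisker_exchange', Category.assoc]
  whiskerLeft_id := whiskerLeft_id'
  id_whiskerRight := id_whiskerRight'
  associator_naturality f g h := by
    simp only [tensorHom_def'', whiskerLeft_comp', comp_whiskerRight', Category.assoc,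
      tensor_whiskerLeft', whiskerRight_tensor', whisker_assoc', Iso.inv_hom_id,
      Iso.hom_inv_id_assoc, Iso.inv_hom_id_assoc, Category.comp_id]
  leftUnitor_naturality f := by
    rw [id_whiskerLeft', Category.assoc, Category.assoc, Iso.inv_hom_id, Category.comp_id]
  rightUnitor_naturality f := by
    rw [whiskerRight_id', Category.assoc, Category.assoc, Iso.inv_hom_id, Category.comp_id]
  pentagon _ _ _ _ := cls_eq (Eqv.pentagon _ _ _ _)
  triangle _ _ := cls_eq (Eqv.triangle _ _)

theorem whiskerLeft_smul' {Y Z : Presented P} (X : Presented P) (c : ℂ) (f : Y ⟶ Z) :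
    X ◁ (c • f) = c • (X ◁ f) := by
  induction f using Quotient.ind
  exact cls_eq (Eqv.whiskerLeft_smul _ _ _)

theorem smul_whiskerRight' {Y Z : Presented P} (c : ℂ) (f : Y ⟶ Z) (X : Presented P) :
    (c • f) ▷ X = c • (f ▷ X) := by
  induction f using Quotient.ind
  exact cls_eq (Eqv.smul_whiskerRight _ _ _)

instance instMonoidalPreadditive : MonoidalPreadditive (Presented P) where
  whiskerLeft_zero {X Y Z} := by
    rw [← zero_smul ℂ (0 : Y ⟶ Z), whiskerLeft_smul', zero_smul]
  zero_whiskerRight {X Y Z} := by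
    rw [← zero_smul ℂ (0 : Y ⟶ Z), smul_whiskerRight', zero_smul]
  whiskerLeft_add f g := by
    induction f using Quotient.ind
    induction g using Quotient.ind
    exact cls_eq (Eqv.whiskerLeft_add _ _ _)
  add_whiskerRight f g := by
    induction f using Quotient.ind
    induction g using Quotient.ind
    exact cls_eq (Eqv.add_whiskerRight _ _ _)

instance instMonoidalLinear : MonoidalLinear ℂ (Presented P) where
  whiskerLeft_smul X _ _ c f := whiskerLeft_smul' X c f
  smul_whiskerRight c _ _ f X := smul_whiskerRight' c f X

section lift

universe v u

variable {D : Type u} [Category.{v} D] [Preadditive D] [Linear ℂ D] [MonoidalCategory D]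
  [MonoidalPreadditive D] [MonoidalLinear ℂ D]

/-- The object of `D` obtained from a word by evaluating its letters. -/
def wordValue {O : Type} (F : O → D) : Word O → D
  | Word.unit => 𝟙_ D
  | Word.of o => F o
  | Word.tensor x y => wordValue F x ⊗ wordValue F y

/-- The morphism of `D` obtained from an expression by evaluating its generators. -/
def exprValue {O : Type} {G : Word O → Word O → Type} (F : O → D)
    (Φ : ∀ {x y : Word O}, G x y → (wordValue F x ⟶ wordValue F y)) :
    ∀ {x y : Word O}, Term G x y → (wordValue F x ⟶ wordValue F y)
  | _, _, Term.gen g => Φ g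
  | _, _, Term.ident _ => 𝟙 _
  | _, _, Term.comp f g => exprValue F Φ f ≫ exprValue F Φ g
  | _, _, Term.whiskerLeft x f => wordValue F x ◁ exprValue F Φ f
  | _, _, Term.whiskerRight f z => exprValue F Φ f ▷ wordValue F z
  | _, _, Term.assocHom x y z => (α_ (wordValue F x) (wordValue F y) (wordValue F z)).hom
  | _, _, Term.assocInv x y z => (α_ (wordValue F x) (wordValue F y) (wordValue F z)).inv
  | _, _, Term.leftHom x => (λ_ (wordValue F x)).hom
  | _, _, Term.leftInv x => (λ_ (wordValue F x)).inv
  | _, _, Term.rightHom x => (ρ_ (wordValue F x)).hom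
  | _, _, Term.rightInv x => (ρ_ (wordValue F x)).inv
  | _, _, Term.zero _ _ => 0
  | _, _, Term.add f g => exprValue F Φ f + exprValue F Φ g
  | _, _, Term.smul c f => c • exprValue F Φ f

theorem exprValue_sound {P : Presentation} (F : P.O → D)
    (Φ : ∀ {x y : Word P.O}, P.G x y → (wordValue F x ⟶ wordValue F y))
    (hΦ : ∀ {x y : Word P.O} {f g : Term P.G x y}, P.rel f g →
      exprValue F Φ f = exprValue F Φ g)
    {x y : Word P.O} {f g : Term P.G x y} (h : Eqv P.rel f g) :
    exprValue F Φ f = exprValue F Φ g := by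
  induction h with
  | rel h => exact hΦ h
  | refl => rfl
  | symm _ ih => exact ih.symm
  | trans _ _ ih ih' => exact ih.trans ih'
  | comp_congr _ _ ih ih' => simp only [exprValue, ih, ih']
  | whiskerLeft_congr _ _ ih => simp only [exprValue, ih]; rfl
  | whiskerRight_congr _ _ ih => simp only [exprValue, ih]; rfl
  | add_congr _ _ ih ih' => simp only [exprValue, ih, ih']
  | smul_congr _ _ ih => simp only [exprValue, ih]
  | whisker_exchange => exact MonoidalCategory.whisker_exchange _ _
  | add_comm => exact _root_.add_comm _ _
  | add_assoc => exact _root_.add_assoc _ _ _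
  | add_smul => exact _root_.add_smul _ _ _
  | mul_smul => exact SemigroupAction.mul_smul _ _ _
  | whiskerLeft_add => exact MonoidalPreadditive.whiskerLeft_add _ _
  | whiskerLeft_smul => exact MonoidalLinear.whiskerLeft_smul _ _ _
  | add_whiskerRight => exact MonoidalPreadditive.add_whiskerRight _ _
  | smul_whiskerRight => exact MonoidalLinear.smul_whiskerRight _ _ _
  | _ => simp [exprValue, wordValue]

/-- The strict monoidal `ℂ`-linear functor out of a presented category which is determined by the
images of the generators. -/
def lift {P : Presentation} (F : P.O → D)
    (Φ : ∀ {x y : Word P.O}, P.G x y → (wordValue F x ⟶ wordValue F y))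
    (hΦ : ∀ {x y : Word P.O} {f g : Term P.G x y}, P.rel f g →
      exprValue F Φ f = exprValue F Φ g) : Presented P ⥤ D where
  obj X := wordValue F X.word
  map f := Quotient.lift (exprValue F Φ) (fun _ _ h => exprValue_sound F Φ hΦ h) f
  map_id _ := rfl
  map_comp f g := by
    induction f using Quotient.ind
    induction g using Quotient.ind
    rfl

end lift

end Presented


section presentations

open Term

local infixr:70 " ⊠ " => Word.tensor
local infixr:80 " ⨟ " => Term.comp
local infixr:81 " ◃ " => Term.whiskerLeft
local infixl:81 " ▹ " => Term.whiskerRight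

/-- The object `k` of the web category. A strand labelled `0` is erased, so the object `0` is the
monoidal unit; the letter `n` stands for the generating object `n + 1`. -/
def strand : ℕ → Word ℕ
  | 0 => Word.unit
  | n + 1 => Word.of n

/-- Generating morphisms of the web category: caps and cups, which exhibit every positive label as
a self-dual object, the two families of trivalent merge vertices, and the split vertices (which
the relations below force to be the merge vertices turned by a half-turn). -/
inductive WebGen : Word ℕ → Word ℕ → Type
  | cap (k : ℕ) : WebGen (strand (k + 1) ⊠ strand (k + 1)) Word.unit
  | cup (k : ℕ) : WebGen Word.unit (strand (k + 1) ⊠ strand (k + 1))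
  | mergeL (k : ℕ) : WebGen (strand 1 ⊠ strand (k + 1)) (strand (k + 2))
  | mergeR (k : ℕ) : WebGen (strand (k + 1) ⊠ strand 1) (strand (k + 2))
  | splitL (k : ℕ) : WebGen (strand (k + 2)) (strand 1 ⊠ strand (k + 1))
  | splitR (k : ℕ) : WebGen (strand (k + 2)) (strand (k + 1) ⊠ strand 1)

namespace WebTerm

/-- The cap `k ⊗ k ⟶ 0`. -/
def cap : ∀ k : ℕ, Term WebGen (strand k ⊠ strand k) Word.unit
  | 0 => leftHom Word.unit
  | k + 1 => gen (WebGen.cap k)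

/-- The cup `0 ⟶ k ⊗ k`. -/
def cup : ∀ k : ℕ, Term WebGen Word.unit (strand k ⊠ strand k)
  | 0 => leftInv Word.unit
  | k + 1 => gen (WebGen.cup k)

/-- The trivalent vertex `1 ⊗ k ⟶ k + 1`. -/
def mergeL : ∀ k : ℕ, Term WebGen (strand 1 ⊠ strand k) (strand (k + 1))
  | 0 => rightHom (strand 1)
  | k + 1 => gen (WebGen.mergeL k)

/-- The trivalent vertex `k ⊗ 1 ⟶ k + 1`. -/
def mergeR : ∀ k : ℕ, Term WebGen (strand k ⊠ strand 1) (strand (k + 1))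
  | 0 => leftHom (strand 1)
  | k + 1 => gen (WebGen.mergeR k)

/-- The trivalent vertex `k + 1 ⟶ 1 ⊗ k`. -/
def splitL : ∀ k : ℕ, Term WebGen (strand (k + 1)) (strand 1 ⊠ strand k)
  | 0 => rightInv (strand 1)
  | k + 1 => gen (WebGen.splitL k)

/-- The trivalent vertex `k + 1 ⟶ k ⊗ 1`. -/
def splitR : ∀ k : ℕ, Term WebGen (strand (k + 1)) (strand k ⊠ strand 1)
  | 0 => leftInv (strand 1)
  | k + 1 => gen (WebGen.splitR k)

/-- Two nested caps `(a ⊗ b) ⊗ (b ⊗ a) ⟶ 0`. -/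
def nest (a b : ℕ) :
    Term WebGen ((strand a ⊠ strand b) ⊠ (strand b ⊠ strand a)) Word.unit :=
  assocHom _ _ _ ⨟ strand a ◃ (assocInv _ _ _ ⨟ cap b ▹ strand a ⨟ leftHom _) ⨟ cap a

/-- The web `k ⊗ k ⟶ 1 ⊗ 1` with a horizontal edge labelled `k + 1`. -/
def ladderUp (k : ℕ) : Term WebGen (strand k ⊠ strand k) (strand 1 ⊠ strand 1) :=
  (leftInv _ ⨟ cup 1 ▹ strand k ⨟ assocHom _ _ _ ⨟ strand 1 ◃ mergeL k) ▹ strand k ⨟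
    assocHom _ _ _ ⨟
    strand 1 ◃ (splitL k ▹ strand k ⨟ assocHom _ _ _ ⨟ strand 1 ◃ cap k ⨟ rightHom _)

/-- The web `k + 1 ⊗ k + 1 ⟶ 1 ⊗ 1` with a horizontal edge labelled `k`. -/
def ladderDown (k : ℕ) :
    Term WebGen (strand (k + 1) ⊠ strand (k + 1)) (strand 1 ⊠ strand 1) :=
  splitL k ▹ strand (k + 1) ⨟ (strand 1 ⊠ strand k) ◃ splitR k ⨟ assocHom _ _ _ ⨟
    strand 1 ◃ (assocInv _ _ _ ⨟ cap k ▹ strand 1 ⨟ leftHom _)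

end WebTerm

open WebTerm in
/-- The defining relations of the web category of `O(m)` over `ℂ`. -/
inductive WebRel (m : ℕ) : ∀ {x y : Word ℕ}, Term WebGen x y → Term WebGen x y → Prop
  -- every label is self-dual
  | zigzagL (k : ℕ) : WebRel m
      (leftInv _ ⨟ cup k ▹ strand k ⨟ assocHom _ _ _ ⨟ strand k ◃ cap k ⨟ rightHom _)
      (ident (strand k))
  | zigzagR (k : ℕ) : WebRel m
      (rightInv _ ⨟ strand k ◃ cup k ⨟ assocInv _ _ _ ⨟ cap k ▹ strand k ⨟ leftHom _)
      (ident (strand k))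
  -- the split vertices are the merge vertices turned by a half-turn, in either direction
  | rotateL (k : ℕ) : WebRel m
      (strand (k + 1) ◃ mergeL k ⨟ cap (k + 1))
      (splitR k ▹ (strand 1 ⊠ strand k) ⨟ nest k 1)
  | rotateL' (k : ℕ) : WebRel m
      (mergeL k ▹ strand (k + 1) ⨟ cap (k + 1))
      ((strand 1 ⊠ strand k) ◃ splitR k ⨟ nest 1 k)
  | rotateR (k : ℕ) : WebRel m
      (strand (k + 1) ◃ mergeR k ⨟ cap (k + 1))
      (splitL k ▹ (strand k ⊠ strand 1) ⨟ nest 1 k)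
  | rotateR' (k : ℕ) : WebRel m
      (mergeR k ▹ strand (k + 1) ⨟ cap (k + 1))
      ((strand k ⊠ strand 1) ◃ splitL k ⨟ nest k 1)
  -- strands labelled by `k > m` vanish
  | vanish (k : ℕ) (hk : m < k) : WebRel m (ident (strand k)) (zero _ _)
  -- a circle labelled `1` is `m`
  | circle : WebRel m (cup 1 ⨟ cap 1) (smul (m : ℂ) (ident Word.unit))
  -- a loop labelled `1` on a strand labelled `2` vanishes
  | monogon : WebRel m (splitL 1 ⨟ cap 1) (zero _ _)
  -- the bigon with sides `1` and `k` on a strand labelled `k + 1`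
  | bigon (k : ℕ) : WebRel m (splitL k ⨟ mergeL k) (smul ((k : ℂ) + 1) (ident (strand (k + 1))))
  -- associativity
  | assoc (k : ℕ) : WebRel m
      (mergeL k ▹ strand 1 ⨟ mergeR (k + 1))
      (assocHom _ _ _ ⨟ strand 1 ◃ mergeR k ⨟ mergeL (k + 1))
  -- the relation between horizontal edges labelled `k + 2` and `k`
  | ladder (k : ℕ) : WebRel m
      (ladderUp (k + 1))
      (add (ladderDown k ⨟ mergeR 1 ⨟ splitR 1)
        (add (smul (-1) (ladderDown k)) (cap (k + 1) ⨟ cup 1)))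

/-- The presentation of the web category of `O(m)` over `ℂ`. -/
def webPresentation (m : ℕ) : Presentation where
  O := ℕ
  G := WebGen
  rel := WebRel m

/-- The web category `Web_ℂ(O(m))`. -/
abbrev Web (m : ℕ) := Presented (webPresentation m)

/-- The generating object of the Brauer category. -/
def pt : Word Unit := Word.of ()

/-- Generating morphisms of the Brauer category. -/
inductive BrauerGen : Word Unit → Word Unit → Type
  | cross : BrauerGen (pt ⊠ pt) (pt ⊠ pt)
  | cap : BrauerGen (pt ⊠ pt) Word.unit
  | cup : BrauerGen Word.unit (pt ⊠ pt)

namespace BrauerTerm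

/-- The crossing. -/
def cross : Term BrauerGen (pt ⊠ pt) (pt ⊠ pt) := gen BrauerGen.cross

/-- The cap. -/
def cap : Term BrauerGen (pt ⊠ pt) Word.unit := gen BrauerGen.cap

/-- The cup. -/
def cup : Term BrauerGen Word.unit (pt ⊠ pt) := gen BrauerGen.cup

/-- The crossing of the second and third strand, out of three. -/
def cross₂ : Term BrauerGen ((pt ⊠ pt) ⊠ pt) ((pt ⊠ pt) ⊠ pt) :=
  assocHom _ _ _ ⨟ pt ◃ cross ⨟ assocInv _ _ _

end BrauerTerm

open BrauerTerm in
/-- The defining relations of the Brauer category with parameter `m`. -/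
inductive BrauerRel (m : ℕ) : ∀ {x y : Word Unit}, Term BrauerGen x y → Term BrauerGen x y → Prop
  -- the generating object is self-dual
  | zigzagL : BrauerRel m
      (leftInv _ ⨟ cup ▹ pt ⨟ assocHom _ _ _ ⨟ pt ◃ cap ⨟ rightHom _) (ident pt)
  | zigzagR : BrauerRel m
      (rightInv _ ⨟ pt ◃ cup ⨟ assocInv _ _ _ ⨟ cap ▹ pt ⨟ leftHom _) (ident pt)
  -- the crossing is an involution and satisfies the braid relation
  | involution : BrauerRel m (cross ⨟ cross) (ident _)
  | braid : BrauerRel m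
      (cross ▹ pt ⨟ cross₂ ⨟ cross ▹ pt) (cross₂ ⨟ cross ▹ pt ⨟ cross₂)
  -- caps absorb crossings, and strands slide through caps
  | untwist : BrauerRel m (cross ⨟ cap) cap
  | slide : BrauerRel m
      (cross ▹ pt ⨟ assocHom _ _ _ ⨟ pt ◃ cap ⨟ rightHom _)
      (cross₂ ⨟ cap ▹ pt ⨟ leftHom _)
  -- a circle is `m`
  | circle : BrauerRel m (cup ⨟ cap) (smul (m : ℂ) (ident Word.unit))

/-- The presentation of the Brauer category with parameter `m`. -/
def brauerPresentation (m : ℕ) : Presentation where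
  O := Unit
  G := BrauerGen
  rel := BrauerRel m

/-- The Brauer category with parameter `m`, over `ℂ`. -/
abbrev Brauer (m : ℕ) := Presented (brauerPresentation m)

end presentations

section abstract

universe v u

variable {D : Type u} [Category.{v} D] [MonoidalCategory D]

/-- nested caps -/
def nestHom {A B : D} (cA : A ⊗ A ⟶ 𝟙_ D) (cB : B ⊗ B ⟶ 𝟙_ D) : (A ⊗ B) ⊗ (B ⊗ A) ⟶ 𝟙_ D :=
  (α_ _ _ _).hom ≫ A ◁ ((α_ _ _ _).inv ≫ cB ▷ A ≫ (λ_ _).hom) ≫ cA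

/-- quarter turn -/
def quarter {V L : D} (cV : V ⊗ V ⟶ 𝟙_ D) (uL : 𝟙_ D ⟶ L ⊗ L) (f : L ⊗ L ⟶ V ⊗ V) :
    L ⊗ V ⟶ L ⊗ V :=
  𝟙 _ ⊗≫ uL ▷ (L ⊗ V) ⊗≫ L ◁ f ▷ V ⊗≫ (L ⊗ V) ◁ cV ⊗≫ 𝟙 _

/-- ladder up -/
def ladderUpHom {V K L : D} (uV : 𝟙_ D ⟶ V ⊗ V) (cK : K ⊗ K ⟶ 𝟙_ D)
    (mL : V ⊗ K ⟶ L) (sL : L ⟶ V ⊗ K) : K ⊗ K ⟶ V ⊗ V :=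
  ((λ_ _).inv ≫ uV ▷ K ≫ (α_ _ _ _).hom ≫ V ◁ mL) ▷ K ≫ (α_ _ _ _).hom ≫
    V ◁ (sL ▷ K ≫ (α_ _ _ _).hom ≫ V ◁ cK ≫ (ρ_ _).hom)

/-- ladder down -/
def ladderDownHom {V K L : D} (cK : K ⊗ K ⟶ 𝟙_ D)
    (sL : L ⟶ V ⊗ K) (sR : L ⟶ K ⊗ V) : L ⊗ L ⟶ V ⊗ V :=
  sL ▷ L ≫ (V ⊗ K) ◁ sR ≫ (α_ _ _ _).hom ≫
    V ◁ ((α_ _ _ _).inv ≫ cK ▷ V ≫ (λ_ _).hom)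

theorem zig_reduce {V : D} {c : V ⊗ V ⟶ 𝟙_ D} {u : 𝟙_ D ⟶ V ⊗ V}
    (zL : (λ_ V).inv ≫ u ▷ V ≫ (α_ _ _ _).hom ≫ V ◁ c ≫ (ρ_ V).hom = 𝟙 V) :
    u ▷ V ⊗≫ V ◁ c = (λ_ V).hom ≫ (ρ_ V).inv := by
  have : u ▷ V ⊗≫ V ◁ c = (λ_ V).hom ≫ ((λ_ V).inv ≫ u ▷ V ≫ (α_ _ _ _).hom ≫ V ◁ c ≫
      (ρ_ V).hom) ≫ (ρ_ V).inv := by monoidal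
  rw [this, zL]; simp

theorem zag_reduce {V : D} {c : V ⊗ V ⟶ 𝟙_ D} {u : 𝟙_ D ⟶ V ⊗ V}
    (zR : (ρ_ V).inv ≫ V ◁ u ≫ (α_ _ _ _).inv ≫ c ▷ V ≫ (λ_ V).hom = 𝟙 V) :
    V ◁ u ⊗≫ c ▷ V = (ρ_ V).hom ≫ (λ_ V).inv := by
  have : V ◁ u ⊗≫ c ▷ V = (ρ_ V).hom ≫ ((ρ_ V).inv ≫ V ◁ u ≫ (α_ _ _ _).inv ≫ c ▷ V ≫
      (λ_ V).hom) ≫ (λ_ V).inv := by monoidal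
  rw [this, zR]; simp

/-- The quarter turn of a ladder is a merge followed by a split. -/
theorem quarter_ladderUp {V K L : D} {cV : V ⊗ V ⟶ 𝟙_ D} {uV : 𝟙_ D ⟶ V ⊗ V}
    {cK : K ⊗ K ⟶ 𝟙_ D} {uK : 𝟙_ D ⟶ K ⊗ K} {cL : L ⊗ L ⟶ 𝟙_ D}
    {mL : V ⊗ K ⟶ L} {mR : K ⊗ V ⟶ L} {sL : L ⟶ V ⊗ K} {sR : L ⟶ K ⊗ V}
    (zV : (λ_ V).inv ≫ uV ▷ V ≫ (α_ _ _ _).hom ≫ V ◁ cV ≫ (ρ_ V).hom = 𝟙 V)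
    (zK : (λ_ K).inv ≫ uK ▷ K ≫ (α_ _ _ _).hom ≫ K ◁ cK ≫ (ρ_ K).hom = 𝟙 K)
    (rR : L ◁ mR ≫ cL = sL ▷ (K ⊗ V) ≫ nestHom cV cK)
    (rL : mL ▷ L ≫ cL = (V ⊗ K) ◁ sR ≫ nestHom cV cK) :
    quarter cV uK (ladderUpHom uV cK mL sL) = mR ≫ sR := by
  calc _ = 𝟙 _ ⊗≫ uK ▷ (K ⊗ V) ⊗≫ K ◁ uV ▷ (K ⊗ K ⊗ V) ⊗≫ (K ⊗ V) ◁ mL ▷ (K ⊗ V) ⊗≫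
        (K ⊗ V) ◁ (sL ▷ (K ⊗ V) ≫ nestHom cV cK) ⊗≫ 𝟙 _ := by
          simp only [quarter, ladderUpHom, nestHom]; monoidal
    _ = 𝟙 _ ⊗≫ uK ▷ (K ⊗ V) ⊗≫ K ◁ uV ▷ (K ⊗ K ⊗ V) ⊗≫
        (K ⊗ V) ◁ (mL ▷ (K ⊗ V) ≫ L ◁ mR) ⊗≫ (K ⊗ V) ◁ cL ⊗≫ 𝟙 _ := by
          rw [← rR]; monoidal
    _ = 𝟙 _ ⊗≫ uK ▷ (K ⊗ V) ⊗≫ K ◁ uV ▷ (K ⊗ K ⊗ V) ⊗≫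
        (K ⊗ V ⊗ V ⊗ K) ◁ mR ⊗≫ (K ⊗ V) ◁ (mL ▷ L ≫ cL) ⊗≫ 𝟙 _ := by
          rw [← whisker_exchange]; monoidal
    _ = 𝟙 _ ⊗≫ uK ▷ (K ⊗ V) ⊗≫ K ◁ (uV ▷ (K ⊗ K ⊗ V) ≫ (V ⊗ V) ◁ (K ◁ (mR ≫ sR))) ⊗≫
        (K ⊗ V) ◁ nestHom cV cK ⊗≫ 𝟙 _ := by
          rw [rL]; monoidal
    _ = 𝟙 _ ⊗≫ (uK ▷ (K ⊗ V) ≫ (K ⊗ K) ◁ (mR ≫ sR)) ⊗≫ K ◁ uV ▷ (K ⊗ K ⊗ V) ⊗≫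
        (K ⊗ V) ◁ nestHom cV cK ⊗≫ 𝟙 _ := by
          rw [← whisker_exchange]; monoidal
    _ = (mR ≫ sR) ⊗≫ uK ▷ (K ⊗ V) ⊗≫ K ◁ (uV ▷ (K ⊗ K ⊗ V) ≫ (V ⊗ V) ◁ ((α_ _ _ _).inv ≫ cK ▷ V ≫ (λ_ V).hom))
         ⊗≫ (K ⊗ V) ◁ cV ⊗≫ 𝟙 _ := by
          rw [← whisker_exchange, nestHom]; monoidal
    _ = (mR ≫ sR) ⊗≫ (uK ▷ K ⊗≫ K ◁ cK) ▷ V ⊗≫ K ◁ (uV ▷ V ⊗≫ V ◁ cV) ⊗≫ 𝟙 _ := by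
          rw [← whisker_exchange]; monoidal
    _ = mR ≫ sR := by rw [zig_reduce zV, zig_reduce zK]; monoidal

/-- A cup followed by a split is a pair of nested cups followed by a merge. -/
theorem cup_split {V K L : D} {cV : V ⊗ V ⟶ 𝟙_ D} {uV : 𝟙_ D ⟶ V ⊗ V}
    {cK : K ⊗ K ⟶ 𝟙_ D} {uK : 𝟙_ D ⟶ K ⊗ K} {cL : L ⊗ L ⟶ 𝟙_ D} {uL : 𝟙_ D ⟶ L ⊗ L}
    {mR : K ⊗ V ⟶ L} {sL : L ⟶ V ⊗ K}
    (zV : (ρ_ V).inv ≫ V ◁ uV ≫ (α_ _ _ _).inv ≫ cV ▷ V ≫ (λ_ V).hom = 𝟙 V)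
    (zK : (ρ_ K).inv ≫ K ◁ uK ≫ (α_ _ _ _).inv ≫ cK ▷ K ≫ (λ_ K).hom = 𝟙 K)
    (zL : (λ_ L).inv ≫ uL ▷ L ≫ (α_ _ _ _).hom ≫ L ◁ cL ≫ (ρ_ L).hom = 𝟙 L)
    (rR : L ◁ mR ≫ cL = sL ▷ (K ⊗ V) ≫ nestHom cV cK) :
    uL ≫ L ◁ sL = uK ⊗≫ K ◁ uV ▷ K ⊗≫ mR ▷ (V ⊗ K) := by
  symm
  calc _ = uK ⊗≫ K ◁ uV ▷ K ⊗≫ mR ▷ (V ⊗ K) ⊗≫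
        ((λ_ L).inv ≫ uL ▷ L ≫ (α_ _ _ _).hom ≫ L ◁ cL ≫ (ρ_ L).hom) ▷ (V ⊗ K) ≫ 𝟙 _ := by
          rw [zL]; monoidal
    _ = uK ⊗≫ K ◁ uV ▷ K ⊗≫ (𝟙_ D ◁ mR ≫ uL ▷ L) ▷ (V ⊗ K) ⊗≫
        (L ◁ cL) ▷ (V ⊗ K) ⊗≫ 𝟙 _ := by monoidal
    _ = uK ⊗≫ K ◁ uV ▷ K ⊗≫ uL ▷ (K ⊗ V ⊗ V ⊗ K) ⊗≫ L ◁ (L ◁ mR ≫ cL) ▷ (V ⊗ K) ⊗≫ 𝟙 _ := by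
          rw [whisker_exchange]; monoidal
    _ = 𝟙 _ ⊗≫ (𝟙_ D ◁ (uK ⊗≫ K ◁ uV ▷ K) ≫ uL ▷ (K ⊗ (V ⊗ V) ⊗ K)) ⊗≫
        L ◁ sL ▷ (K ⊗ V ⊗ V ⊗ K) ⊗≫ L ◁ nestHom cV cK ▷ (V ⊗ K) ⊗≫ 𝟙 _ := by
          rw [rR]; monoidal
    _ = 𝟙 _ ⊗≫ uL ⊗≫ L ◁ (L ◁ (uK ⊗≫ K ◁ uV ▷ K) ≫
        sL ▷ (K ⊗ (V ⊗ V) ⊗ K)) ⊗≫ L ◁ nestHom cV cK ▷ (V ⊗ K) ⊗≫ 𝟙 _ := by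
          rw [whisker_exchange uL]; monoidal
    _ = uL ⊗≫ L ◁ sL ⊗≫ (L ⊗ V ⊗ K) ◁ (uK ⊗≫ K ◁ uV ▷ K) ⊗≫
        L ◁ nestHom cV cK ▷ (V ⊗ K) ⊗≫ 𝟙 _ := by
          rw [whisker_exchange sL]; monoidal
    _ = uL ⊗≫ L ◁ sL ⊗≫ (L ⊗ V ⊗ K) ◁ uK ⊗≫ L ◁ V ◁ ((K ⊗ K) ◁ uV ≫ cK ▷ (V ⊗ V)) ▷ K ⊗≫
        L ◁ cV ▷ (V ⊗ K) ⊗≫ 𝟙 _ := by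
          rw [nestHom]; monoidal
    _ = uL ⊗≫ L ◁ sL ⊗≫ (L ⊗ V) ◁ (K ◁ uK ⊗≫ cK ▷ K) ⊗≫ L ◁ (V ◁ uV ⊗≫ cV ▷ V) ▷ K ⊗≫ 𝟙 _ := by
          rw [whisker_exchange]; monoidal
    _ = _ := by rw [zag_reduce zV, zag_reduce zK]; monoidal

/-- The quarter turn of a ladder. -/
theorem quarter_ladderDown {V K L : D} {cV : V ⊗ V ⟶ 𝟙_ D} {uV : 𝟙_ D ⟶ V ⊗ V}
    {cK : K ⊗ K ⟶ 𝟙_ D} {uK : 𝟙_ D ⟶ K ⊗ K} {uL : 𝟙_ D ⟶ L ⊗ L}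
    {mR : K ⊗ V ⟶ L} {sL : L ⟶ V ⊗ K} {sR : L ⟶ K ⊗ V}
    (zK : (λ_ K).inv ≫ uK ▷ K ≫ (α_ _ _ _).hom ≫ K ◁ cK ≫ (ρ_ K).hom = 𝟙 K)
    (hu : uL ≫ L ◁ sL = uK ⊗≫ K ◁ uV ▷ K ⊗≫ mR ▷ (V ⊗ K)) (g : V ⊗ V ⟶ V ⊗ V) :
    quarter cV uL (ladderDownHom cK sL sR ≫ g) =
      sR ▷ V ≫ (α_ _ _ _).hom ≫ K ◁ quarter cV uV g ≫ (α_ _ _ _).inv ≫ mR ▷ V := by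
  calc _ = 𝟙 _ ⊗≫ (uL ≫ L ◁ sL) ▷ (L ⊗ V) ⊗≫ (L ⊗ V ⊗ K) ◁ sR ▷ V ⊗≫
        (L ⊗ V) ◁ cK ▷ (V ⊗ V) ⊗≫ L ◁ g ▷ V ⊗≫ (L ⊗ V) ◁ cV ⊗≫ 𝟙 _ := by
          simp only [quarter, ladderDownHom]; monoidal
    _ = 𝟙 _ ⊗≫ (uK ⊗≫ K ◁ uV ▷ K) ▷ (L ⊗ V) ⊗≫ (mR ▷ ((V ⊗ K) ⊗ (L ⊗ V)) ≫ L ◁ ((V ⊗ K) ◁ sR ▷ V ⊗≫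
        V ◁ cK ▷ (V ⊗ V) ⊗≫ g ▷ V ⊗≫ V ◁ cV)) ⊗≫ 𝟙 _ := by
          rw [hu]; monoidal
    _ = 𝟙 _ ⊗≫ ((uK ⊗≫ K ◁ uV ▷ K) ▷ (L ⊗ V) ≫ (K ⊗ (V ⊗ V) ⊗ K) ◁ (sR ▷ V)) ⊗≫ 
        ((K ⊗ V) ◁ (
        V ◁ cK ▷ (V ⊗ V) ⊗≫ g ▷ V ⊗≫ V ◁ cV)) ⊗≫ mR ▷ V ⊗≫ 𝟙 _ := by
          rw [← whisker_exchange]; monoidal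
    _ = 𝟙 _ ⊗≫ sR ▷ V ⊗≫ uK ▷ (K ⊗ V ⊗ V) ⊗≫ K ◁ (uV ▷ ((K ⊗ K) ⊗ (V ⊗ V)) ≫ (V ⊗ V) ◁ (cK ▷ (V ⊗ V))) ⊗≫
        ((K ⊗ V) ◁ (g ▷ V ⊗≫ V ◁ cV)) ⊗≫ mR ▷ V ⊗≫ 𝟙 _ := by
          rw [← whisker_exchange]; monoidal
    _ = 𝟙 _ ⊗≫ sR ▷ V ⊗≫ (uK ▷ K ⊗≫ K ◁ cK) ▷ (V ⊗ V) ⊗≫ K ◁ uV ▷ (V ⊗ V) ⊗≫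
        ((K ⊗ V) ◁ (g ▷ V ⊗≫ V ◁ cV)) ⊗≫ mR ▷ V ⊗≫ 𝟙 _ := by
          rw [← whisker_exchange]; monoidal
    _ = _ := by rw [zig_reduce zK, quarter]; monoidal

theorem quarter_id {V : D} (cV : V ⊗ V ⟶ 𝟙_ D) (uV : 𝟙_ D ⟶ V ⊗ V) :
    quarter cV uV (𝟙 (V ⊗ V)) = cV ≫ uV := by
  calc _ = 𝟙 _ ⊗≫ (uV ▷ (V ⊗ V) ≫ (V ⊗ V) ◁ cV) ⊗≫ 𝟙 _ := by rw [quarter]; monoidal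
    _ = _ := by rw [← whisker_exchange]; monoidal

theorem quarter_cap_cup {V L : D} {cV : V ⊗ V ⟶ 𝟙_ D} {uV : 𝟙_ D ⟶ V ⊗ V}
    {cL : L ⊗ L ⟶ 𝟙_ D} {uL : 𝟙_ D ⟶ L ⊗ L}
    (zV : (λ_ V).inv ≫ uV ▷ V ≫ (α_ _ _ _).hom ≫ V ◁ cV ≫ (ρ_ V).hom = 𝟙 V)
    (zL : (λ_ L).inv ≫ uL ▷ L ≫ (α_ _ _ _).hom ≫ L ◁ cL ≫ (ρ_ L).hom = 𝟙 L) :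
    quarter cV uL (cL ≫ uV) = 𝟙 _ := by
  calc _ = (𝟙 _ : L ⊗ V ⟶ _) ⊗≫ (uL ▷ L ⊗≫ L ◁ cL) ▷ V ⊗≫ L ◁ (uV ▷ V ⊗≫ V ◁ cV) ⊗≫ 𝟙 _ := by
          rw [quarter]; monoidal
    _ = _ := by rw [zig_reduce zV, zig_reduce zL]; monoidal

/-- An endomorphism which agrees with its quarter turn slides through caps. -/
theorem slide_of_quarter {V : D} {cV : V ⊗ V ⟶ 𝟙_ D} {uV : 𝟙_ D ⟶ V ⊗ V} {X : V ⊗ V ⟶ V ⊗ V}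
    (zV : (ρ_ V).inv ≫ V ◁ uV ≫ (α_ _ _ _).inv ≫ cV ▷ V ≫ (λ_ V).hom = 𝟙 V)
    (h : quarter cV uV X = X) :
    X ▷ V ≫ (α_ _ _ _).hom ≫ V ◁ cV ≫ (ρ_ V).hom =
      ((α_ _ _ _).hom ≫ V ◁ X ≫ (α_ _ _ _).inv) ≫ cV ▷ V ≫ (λ_ V).hom := by
  symm
  calc _ = (𝟙 _ : (V ⊗ V) ⊗ V ⟶ _) ⊗≫ V ◁ quarter cV uV X ⊗≫ cV ▷ V ⊗≫ 𝟙 _ := by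
          rw [h]; monoidal
    _ = (𝟙 _ : (V ⊗ V) ⊗ V ⟶ _) ⊗≫ V ◁ uV ▷ (V ⊗ V) ⊗≫ ((V ⊗ V) ◁ (X ▷ V ⊗≫ V ◁ cV) ≫
        cV ▷ (V ⊗ 𝟙_ D)) ⊗≫ 𝟙 _ := by rw [quarter]; monoidal
    _ = (𝟙 _ : (V ⊗ V) ⊗ V ⟶ _) ⊗≫ (V ◁ uV ⊗≫ cV ▷ V) ▷ (V ⊗ V) ⊗≫ X ▷ V ⊗≫ V ◁ cV ⊗≫ 𝟙 _ := by
          rw [whisker_exchange]; monoidal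
    _ = _ := by rw [zag_reduce zV]; monoidal

section linear

variable [Preadditive D] [MonoidalPreadditive D]

theorem quarter_add {V L : D} (cV : V ⊗ V ⟶ 𝟙_ D) (uL : 𝟙_ D ⟶ L ⊗ L) (f g : L ⊗ L ⟶ V ⊗ V) :
    quarter cV uL (f + g) = quarter cV uL f + quarter cV uL g := by
  simp [quarter, monoidalComp]

theorem quarter_neg {V L : D} (cV : V ⊗ V ⟶ 𝟙_ D) (uL : 𝟙_ D ⟶ L ⊗ L) (f : L ⊗ L ⟶ V ⊗ V) :
    quarter cV uL (-f) = -quarter cV uL f := by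
  rw [eq_neg_iff_add_eq_zero, ← quarter_add, neg_add_cancel]
  simp [quarter, monoidalComp]

/-- The crossing agrees with its quarter turn. -/
theorem quarter_crossing {V : D} {cV : V ⊗ V ⟶ 𝟙_ D} {uV : 𝟙_ D ⟶ V ⊗ V} {e H : V ⊗ V ⟶ V ⊗ V}
    (zV : (λ_ V).inv ≫ uV ▷ V ≫ (α_ _ _ _).hom ≫ V ◁ cV ≫ (ρ_ V).hom = 𝟙 V)
    (h : H = e + (-𝟙 _ + cV ≫ uV)) (hH : quarter cV uV H = e) :
    quarter cV uV (𝟙 _ - e) = 𝟙 _ - e := by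
  have h1 : quarter cV uV e + (-(cV ≫ uV) + 𝟙 _) = e := by
    have h2 := hH
    rwa [h, quarter_add, quarter_add, quarter_neg, quarter_id, quarter_cap_cup zV zV] at h2
  have h3 : quarter cV uV (𝟙 _ - e) = 𝟙 _ - (quarter cV uV e + (-(cV ≫ uV) + 𝟙 _)) := by
    rw [sub_eq_add_neg (𝟙 _) e, quarter_add, quarter_neg, quarter_id]
    abel
  rw [h3, h1]

/-- The formula expressing a crossing next to a thick strand through a merge and a split. -/
theorem merge_split {V K L T : D} {cV : V ⊗ V ⟶ 𝟙_ D} {uV : 𝟙_ D ⟶ V ⊗ V}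
    {cK : K ⊗ K ⟶ 𝟙_ D} {uK : 𝟙_ D ⟶ K ⊗ K} {cL : L ⊗ L ⟶ 𝟙_ D} {uL : 𝟙_ D ⟶ L ⊗ L}
    {cT : T ⊗ T ⟶ 𝟙_ D}
    {mR : K ⊗ V ⟶ L} {sL : L ⟶ V ⊗ K} {sR : L ⟶ K ⊗ V}
    {mL' : V ⊗ L ⟶ T} {mR' : L ⊗ V ⟶ T} {sL' : T ⟶ V ⊗ L} {sR' : T ⟶ L ⊗ V}
    {e : V ⊗ V ⟶ V ⊗ V}
    (zV : (λ_ V).inv ≫ uV ▷ V ≫ (α_ _ _ _).hom ≫ V ◁ cV ≫ (ρ_ V).hom = 𝟙 V)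
    (zV' : (ρ_ V).inv ≫ V ◁ uV ≫ (α_ _ _ _).inv ≫ cV ▷ V ≫ (λ_ V).hom = 𝟙 V)
    (zK : (λ_ K).inv ≫ uK ▷ K ≫ (α_ _ _ _).hom ≫ K ◁ cK ≫ (ρ_ K).hom = 𝟙 K)
    (zK' : (ρ_ K).inv ≫ K ◁ uK ≫ (α_ _ _ _).inv ≫ cK ▷ K ≫ (λ_ K).hom = 𝟙 K)
    (zL : (λ_ L).inv ≫ uL ▷ L ≫ (α_ _ _ _).hom ≫ L ◁ cL ≫ (ρ_ L).hom = 𝟙 L)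
    (rR : L ◁ mR ≫ cL = sL ▷ (K ⊗ V) ≫ nestHom cV cK)
    (rR' : T ◁ mR' ≫ cT = sL' ▷ (L ⊗ V) ≫ nestHom cV cL)
    (rL' : mL' ▷ T ≫ cT = (V ⊗ L) ◁ sR' ≫ nestHom cV cL)
    (h : ladderUpHom uV cL mL' sL' = ladderDownHom cK sL sR ≫ e +
      (-ladderDownHom cK sL sR + cL ≫ uV))
    (hX : quarter cV uV (𝟙 _ - e) = 𝟙 _ - e) :
    mR' ≫ sR' = 𝟙 _ - sR ▷ V ≫ (α_ _ _ _).hom ≫ K ◁ (𝟙 _ - e) ≫ (α_ _ _ _).inv ≫ mR ▷ V := by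
  have hu := cup_split zV' zK' zL rR
  rw [← quarter_ladderUp zV zL rR' rL']
  have h' : ladderUpHom uV cL mL' sL' = -(ladderDownHom cK sL sR ≫ (𝟙 _ - e)) + cL ≫ uV := by
    rw [h, Preadditive.comp_sub, Category.comp_id]; abel
  rw [h', quarter_add, quarter_neg, quarter_ladderDown zK hu, hX, quarter_cap_cup zV zL]
  abel

end linear

/-- nested pairings -/
def nestPair {A B X Y : D} (r : A ⊗ B ⟶ 𝟙_ D) (p : X ⊗ Y ⟶ 𝟙_ D) :
    (A ⊗ X) ⊗ (Y ⊗ B) ⟶ 𝟙_ D :=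
  𝟙 _ ⊗≫ A ◁ p ▷ B ⊗≫ r

theorem zig_reduce' {V : D} {c : V ⊗ V ⟶ 𝟙_ D} {u : 𝟙_ D ⟶ V ⊗ V}
    (zL : (λ_ V).inv ≫ u ▷ V ≫ (α_ _ _ _).hom ≫ V ◁ c ≫ (ρ_ V).hom = 𝟙 V) :
    u ▷ V ≫ (α_ _ _ _).hom ≫ V ◁ c = (λ_ V).hom ≫ (ρ_ V).inv := by
  rw [← zig_reduce zL]; monoidal

theorem nestPair_zigzag {A B X Y : D} {r : A ⊗ B ⟶ 𝟙_ D} {p : X ⊗ Y ⟶ 𝟙_ D}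
    {r' : 𝟙_ D ⟶ B ⊗ A} {p' : 𝟙_ D ⟶ Y ⊗ X}
    (hr : r' ▷ B ≫ (α_ _ _ _).hom ≫ B ◁ r = (λ_ B).hom ≫ (ρ_ B).inv)
    (hp : p' ▷ Y ≫ (α_ _ _ _).hom ≫ Y ◁ p = (λ_ Y).hom ≫ (ρ_ Y).inv) :
    (p' ⊗≫ Y ◁ r' ▷ X ⊗≫ 𝟙 ((Y ⊗ B) ⊗ (A ⊗ X))) ▷ (Y ⊗ B) ≫ (α_ _ _ _).hom ≫
      (Y ⊗ B) ◁ nestPair r p =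
      (λ_ (Y ⊗ B)).hom ≫ (ρ_ (Y ⊗ B)).inv := by
  calc _ = 𝟙 _ ⊗≫ p' ▷ (Y ⊗ B) ⊗≫ Y ◁ (r' ▷ ((X ⊗ Y) ⊗ B) ≫ (B ⊗ A) ◁ (p ▷ B)) ⊗≫
        (Y ⊗ B) ◁ r ⊗≫ 𝟙 _ := by rw [nestPair]; monoidal
    _ = 𝟙 _ ⊗≫ (p' ▷ Y ≫ (α_ _ _ _).hom ≫ Y ◁ p) ▷ B ⊗≫
        Y ◁ (r' ▷ B ≫ (α_ _ _ _).hom ≫ B ◁ r) ⊗≫ 𝟙 _ := by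
        rw [← whisker_exchange]; monoidal
    _ = _ := by rw [hr, hp]; monoidal

theorem pairing_injective {X Y Z : D} {p : X ⊗ Y ⟶ 𝟙_ D} {p' : 𝟙_ D ⟶ Y ⊗ X}
    (hp : p' ▷ Y ≫ (α_ _ _ _).hom ≫ Y ◁ p = (λ_ Y).hom ≫ (ρ_ Y).inv) {f g : Z ⟶ Y}
    (h : X ◁ f ≫ p = X ◁ g ≫ p) : f = g := by
  have key : ∀ f : Z ⟶ Y, f = 𝟙 _ ⊗≫ p' ▷ Z ⊗≫ Y ◁ (X ◁ f ≫ p) ⊗≫ 𝟙 _ := by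
    intro f
    calc f = 𝟙 _ ⊗≫ (𝟙_ D ◁ f) ⊗≫ (p' ▷ Y ≫ (α_ _ _ _).hom ≫ Y ◁ p) ⊗≫ 𝟙 _ := by rw [hp]; monoidal
      _ = 𝟙 _ ⊗≫ (𝟙_ D ◁ f ≫ p' ▷ Y) ⊗≫ Y ◁ p ⊗≫ 𝟙 _ := by monoidal
      _ = _ := by rw [whisker_exchange]; monoidal
  rw [key f, key g, h]

theorem nestHom_eq {A B : D} (cA : A ⊗ A ⟶ 𝟙_ D) (cB : B ⊗ B ⟶ 𝟙_ D) :
    nestHom cA cB = nestPair cA cB := by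
  rw [nestHom, nestPair]; monoidal

section braid

variable [Preadditive D] [MonoidalPreadditive D] [Linear ℂ D]

theorem braid_relation {V W T : D} {cV : V ⊗ V ⟶ 𝟙_ D} {uV : 𝟙_ D ⟶ V ⊗ V} {cW : W ⊗ W ⟶ 𝟙_ D}
    {m : V ⊗ V ⟶ W} {s : W ⟶ V ⊗ V} {mL : V ⊗ W ⟶ T} {mR : W ⊗ V ⟶ T} {sR : T ⟶ W ⊗ V}
    (zV : (λ_ V).inv ≫ uV ▷ V ≫ (α_ _ _ _).hom ≫ V ◁ cV ≫ (ρ_ V).hom = 𝟙 V)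
    (r : W ◁ m ≫ cW = s ▷ (V ⊗ V) ≫ nestHom cV cV)
    (r' : m ▷ W ≫ cW = (V ⊗ V) ◁ s ≫ nestHom cV cV)
    (hsm : s ≫ m = 𝟙 _ + 𝟙 _)
    (assoc : m ▷ V ≫ mR = (α_ _ _ _).hom ≫ V ◁ m ≫ mL)
    (h : mR ≫ sR = 𝟙 _ - s ▷ V ≫ (α_ _ _ _).hom ≫ V ◁ (𝟙 _ - m ≫ s) ≫ (α_ _ _ _).inv ≫ m ▷ V)
    {X : V ⊗ V ⟶ V ⊗ V} (hX : X = 𝟙 _ - m ≫ s)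
    {X₂ : (V ⊗ V) ⊗ V ⟶ (V ⊗ V) ⊗ V} (hX₂ : X₂ = (α_ _ _ _).hom ≫ V ◁ X ≫ (α_ _ _ _).inv) :
    X ▷ V ≫ X₂ ≫ X ▷ V = X₂ ≫ X ▷ V ≫ X₂ := by
  set e := m ≫ s with he
  set e1 : (V ⊗ V) ⊗ V ⟶ (V ⊗ V) ⊗ V := e ▷ V with he1
  set e2 : (V ⊗ V) ⊗ V ⟶ (V ⊗ V) ⊗ V := (α_ _ _ _).hom ≫ V ◁ e ≫ (α_ _ _ _).inv with he2
  have hee : e ≫ e = e + e := by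
    rw [he, Category.assoc, ← Category.assoc s, hsm]; simp
  have h11 : e1 ≫ e1 = e1 + e1 := by
    rw [he1, ← comp_whiskerRight, hee, MonoidalPreadditive.add_whiskerRight]
  have h22 : e2 ≫ e2 = e2 + e2 := by
    have : e2 ≫ e2 = (α_ _ _ _).hom ≫ V ◁ (e ≫ e) ≫ (α_ _ _ _).inv := by rw [he2]; monoidal
    rw [this, hee, MonoidalPreadditive.whiskerLeft_add]; simp [he2]
  have hX1 : X ▷ V = 𝟙 _ - e1 := by
    rw [hX, eq_sub_iff_add_eq, he1, ← MonoidalPreadditive.add_whiskerRight]; simp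
  have hX2 : X₂ = 𝟙 _ - e2 := by
    rw [hX₂, eq_sub_iff_add_eq, he2, ← Preadditive.comp_add, ← Preadditive.add_comp,
      ← MonoidalPreadditive.whiskerLeft_add, hX]; simp
  -- the idempotent (up to scale) onto `T`
  have hF : (m ▷ V ≫ mR) ≫ sR ≫ s ▷ V = e1 ≫ e2 ≫ e1 - e1 := by
    have h1 : (m ▷ V ≫ mR) ≫ sR ≫ s ▷ V = m ▷ V ≫ (mR ≫ sR) ≫ s ▷ V := by
      simp only [Category.assoc]
    have h2 : V ◁ (𝟙 _ - e) = 𝟙 _ - V ◁ e := by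
      rw [eq_sub_iff_add_eq, ← MonoidalPreadditive.whiskerLeft_add]; simp
    have h3 : m ▷ V ≫ s ▷ V = e1 := by rw [he1, he, comp_whiskerRight]
    have h4 : (m ▷ V ≫ mR) ≫ sR ≫ s ▷ V = e1 - e1 ≫ (𝟙 _ - e2) ≫ e1 := by
      rw [h1, h, h2, ← h3, he2]
      simp only [Preadditive.sub_comp, Preadditive.comp_sub, Category.assoc, Category.id_comp,
        Iso.hom_inv_id_assoc]
    rw [h4, Preadditive.sub_comp, Preadditive.comp_sub, Category.id_comp, h11]
    abel
  have hM : e2 ≫ m ▷ V ≫ mR = m ▷ V ≫ mR + m ▷ V ≫ mR := by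
    have h1 : e2 ≫ m ▷ V ≫ mR = (α_ _ _ _).hom ≫ V ◁ (m ≫ s ≫ m) ≫ mL := by
      rw [assoc, he2]; simp [he]
    rw [h1, assoc, hsm]; simp [MonoidalPreadditive.whiskerLeft_add]
  have hstar : e2 ≫ (e1 ≫ e2 ≫ e1 - e1) = (e1 ≫ e2 ≫ e1 - e1) + (e1 ≫ e2 ≫ e1 - e1) := by
    rw [← hF, ← Category.assoc, hM, Preadditive.add_comp]
  -- the transposed relation
  have hN : e ▷ (V ⊗ V) ≫ nestPair cV cV = (V ⊗ V) ◁ e ≫ nestPair cV cV := by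
    rw [← nestHom_eq, he, comp_whiskerRight, Category.assoc, ← r, ← Category.assoc,
      ← whisker_exchange, Category.assoc, r', whiskerLeft_comp, Category.assoc]
  have zz := nestPair_zigzag (zig_reduce' zV)
    (nestPair_zigzag (zig_reduce' zV) (zig_reduce' zV))
  have hA1 : (V ⊗ V ⊗ V) ◁ e1 ≫ nestPair cV (nestPair cV cV) =
      (V ◁ e) ▷ ((V ⊗ V) ⊗ V) ≫ nestPair cV (nestPair cV cV) := by
    calc _ = 𝟙 _ ⊗≫ V ◁ ((V ⊗ V) ◁ e ≫ nestPair cV cV) ▷ V ⊗≫ cV := by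
            simp only [nestPair, he1]; monoidal
      _ = _ := by rw [← hN]; simp only [nestPair]; monoidal
  have hA2 : (V ⊗ V ⊗ V) ◁ e2 ≫ nestPair cV (nestPair cV cV) =
      ((α_ _ _ _).inv ≫ e ▷ V ≫ (α_ _ _ _).hom) ▷ ((V ⊗ V) ⊗ V) ≫
        nestPair cV (nestPair cV cV) := by
    calc _ = 𝟙 _ ⊗≫ ((V ⊗ V) ◁ (cV ▷ (V ⊗ V)) ≫ (V ⊗ V) ◁ (𝟙_ D ◁ e)) ⊗≫ nestPair cV cV := by
            rw [← whiskerLeft_comp, ← whisker_exchange]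
            simp only [nestPair, he2]; monoidal
      _ = 𝟙 _ ⊗≫ (V ⊗ V) ◁ (cV ▷ (V ⊗ V)) ⊗≫ ((V ⊗ V) ◁ e ≫ nestPair cV cV) := by monoidal
      _ = 𝟙 _ ⊗≫ ((V ⊗ V) ◁ (cV ▷ (V ⊗ V)) ≫ e ▷ (𝟙_ D ⊗ (V ⊗ V))) ⊗≫ nestPair cV cV := by
            rw [← hN]; monoidal
      _ = _ := by
            rw [whisker_exchange]; simp only [nestPair]; monoidal
  set N := nestPair cV (nestPair cV cV) with hNdef
  set f1 : V ⊗ V ⊗ V ⟶ V ⊗ V ⊗ V := (α_ _ _ _).inv ≫ e ▷ V ≫ (α_ _ _ _).hom with hf1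
  set f2 : V ⊗ V ⊗ V ⟶ V ⊗ V ⊗ V := V ◁ e with hf2
  have hconj : f2 ≫ (f1 ≫ f2 ≫ f1 - f1) = (f1 ≫ f2 ≫ f1 - f1) + (f1 ≫ f2 ≫ f1 - f1) := by
    have := congrArg (fun t => (α_ V V V).inv ≫ t ≫ (α_ V V V).hom) hstar
    simpa [he1, he2, hf1, hf2, Preadditive.comp_sub, Preadditive.sub_comp, Preadditive.comp_add,
      Preadditive.add_comp, Category.assoc] using this
  have hs1 : ∀ a, (V ⊗ V ⊗ V) ◁ (a ≫ e1) ≫ N = f2 ▷ ((V ⊗ V) ⊗ V) ≫ (V ⊗ V ⊗ V) ◁ a ≫ N := by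
    intro a
    rw [whiskerLeft_comp, Category.assoc, hA1, ← Category.assoc, whisker_exchange, Category.assoc]
  have hs2 : ∀ a, (V ⊗ V ⊗ V) ◁ (a ≫ e2) ≫ N = f1 ▷ ((V ⊗ V) ⊗ V) ≫ (V ⊗ V ⊗ V) ◁ a ≫ N := by
    intro a
    rw [whiskerLeft_comp, Category.assoc, hA2, ← Category.assoc, whisker_exchange, Category.assoc]
  have w2 : (V ⊗ V ⊗ V) ◁ e2 ≫ N = f1 ▷ _ ≫ N := by
    simpa using hs2 (𝟙 _)
  have w21 : (V ⊗ V ⊗ V) ◁ (e2 ≫ e1) ≫ N = (f2 ≫ f1) ▷ _ ≫ N := by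
    rw [hs1, w2, comp_whiskerRight f2 f1, Category.assoc]
  have w212 : (V ⊗ V ⊗ V) ◁ ((e2 ≫ e1) ≫ e2) ≫ N = (f1 ≫ f2 ≫ f1) ▷ _ ≫ N := by
    rw [hs2, w21, comp_whiskerRight f1 (f2 ≫ f1), Category.assoc]
  have w2121 : (V ⊗ V ⊗ V) ◁ (((e2 ≫ e1) ≫ e2) ≫ e1) ≫ N =
      (f2 ≫ f1 ≫ f2 ≫ f1) ▷ _ ≫ N := by
    rw [hs1, w212, comp_whiskerRight f2 (f1 ≫ f2 ≫ f1)]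
    exact (Category.assoc _ _ _).symm
  have hL : ∀ a b : (V ⊗ V) ⊗ V ⟶ (V ⊗ V) ⊗ V, (V ⊗ V ⊗ V) ◁ (a - b) ≫ N =
      (V ⊗ V ⊗ V) ◁ a ≫ N - (V ⊗ V ⊗ V) ◁ b ≫ N := by
    intro a b
    rw [eq_sub_iff_add_eq, ← Preadditive.add_comp, ← MonoidalPreadditive.whiskerLeft_add,
      sub_add_cancel]
  have hR : ∀ a b : V ⊗ V ⊗ V ⟶ V ⊗ V ⊗ V, (a - b) ▷ ((V ⊗ V) ⊗ V) ≫ N =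
      a ▷ _ ≫ N - b ▷ _ ≫ N := by
    intro a b
    rw [eq_sub_iff_add_eq, ← Preadditive.add_comp, ← MonoidalPreadditive.add_whiskerRight,
      sub_add_cancel]
  have htrans : ((e2 ≫ e1) ≫ e2) ≫ e1 - e2 ≫ e1 =
      ((e2 ≫ e1) ≫ e2 - e2) + ((e2 ≫ e1) ≫ e2 - e2) := by
    apply pairing_injective zz
    rw [hL, w2121, w21, ← hR, ← Preadditive.comp_sub f2, ← Category.comp_id f1]
    simp only [Category.comp_id]
    rw [MonoidalPreadditive.whiskerLeft_add, Preadditive.add_comp, hL, w212, w2, ← hR,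
      ← Preadditive.add_comp, ← MonoidalPreadditive.add_whiskerRight, ← hconj]
  have hfin : e1 ≫ e2 ≫ e1 - e1 = e2 ≫ e1 ≫ e2 - e2 := by
    have h2 : (e1 ≫ e2 ≫ e1 - e1) + (e1 ≫ e2 ≫ e1 - e1) =
        (e2 ≫ e1 ≫ e2 - e2) + (e2 ≫ e1 ≫ e2 - e2) := by
      rw [← hstar]
      simpa only [Category.assoc, Preadditive.comp_sub] using htrans
    rw [← two_smul ℂ, ← two_smul ℂ] at h2
    have h3 := congrArg (fun t => (2 : ℂ)⁻¹ • t) h2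
    simpa [smul_smul] using h3
  rw [hX1, hX2]
  simp only [Preadditive.sub_comp, Preadditive.comp_sub, Category.id_comp, Category.comp_id]
  rw [h11, h22]
  have h4 : e1 ≫ e2 ≫ e1 = (e2 ≫ e1 ≫ e2 - e2) + e1 := by rw [← hfin]; abel
  rw [h4]
  abel

end braid

end abstract

namespace Web

variable (m : ℕ)

/-- The object `k` of the web category. -/
abbrev S (k : ℕ) : Web m := Presented.ofWord (strand k)

/-- The cap `k ⊗ k ⟶ 0`. -/
def cap (k : ℕ) : S m k ⊗ S m k ⟶ 𝟙_ (Web m) := Presented.cls (P := webPresentation m) (WebTerm.cap k)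

/-- The cup `0 ⟶ k ⊗ k`. -/
def cup (k : ℕ) : 𝟙_ (Web m) ⟶ S m k ⊗ S m k := Presented.cls (P := webPresentation m) (WebTerm.cup k)

/-- The trivalent vertex `1 ⊗ k ⟶ k + 1`. -/
def mergeL (k : ℕ) : S m 1 ⊗ S m k ⟶ S m (k + 1) :=
  Presented.cls (P := webPresentation m) (WebTerm.mergeL k)

/-- The trivalent vertex `k ⊗ 1 ⟶ k + 1`. -/
def mergeR (k : ℕ) : S m k ⊗ S m 1 ⟶ S m (k + 1) :=
  Presented.cls (P := webPresentation m) (WebTerm.mergeR k)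

/-- The trivalent vertex `k + 1 ⟶ 1 ⊗ k`. -/
def splitL (k : ℕ) : S m (k + 1) ⟶ S m 1 ⊗ S m k :=
  Presented.cls (P := webPresentation m) (WebTerm.splitL k)

/-- The trivalent vertex `k + 1 ⟶ k ⊗ 1`. -/
def splitR (k : ℕ) : S m (k + 1) ⟶ S m k ⊗ S m 1 :=
  Presented.cls (P := webPresentation m) (WebTerm.splitR k)

/-- The crossing of two strands labelled `1`: the identity minus the web which merges both strands
and splits them again. -/
def crossing : S m 1 ⊗ S m 1 ⟶ S m 1 ⊗ S m 1 := 𝟙 _ - mergeR m 1 ≫ splitR m 1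

theorem zigzagL (k : ℕ) : (λ_ (S m k)).inv ≫ cup m k ▷ S m k ≫ (α_ _ _ _).hom ≫
    S m k ◁ cap m k ≫ (ρ_ _).hom = 𝟙 _ :=
  Presented.cls_eq (P := webPresentation m) (Eqv.rel (WebRel.zigzagL k))

theorem zigzagR (k : ℕ) : (ρ_ (S m k)).inv ≫ S m k ◁ cup m k ≫ (α_ _ _ _).inv ≫
    cap m k ▷ S m k ≫ (λ_ _).hom = 𝟙 _ :=
  Presented.cls_eq (P := webPresentation m) (Eqv.rel (WebRel.zigzagR k))

theorem rotateL (k : ℕ) : S m (k + 1) ◁ mergeL m k ≫ cap m (k + 1) =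
    splitR m k ▷ (S m 1 ⊗ S m k) ≫ nestHom (cap m k) (cap m 1) :=
  Presented.cls_eq (P := webPresentation m) (Eqv.rel (WebRel.rotateL k))

theorem rotateL' (k : ℕ) : mergeL m k ▷ S m (k + 1) ≫ cap m (k + 1) =
    (S m 1 ⊗ S m k) ◁ splitR m k ≫ nestHom (cap m 1) (cap m k) :=
  Presented.cls_eq (P := webPresentation m) (Eqv.rel (WebRel.rotateL' k))

theorem rotateR (k : ℕ) : S m (k + 1) ◁ mergeR m k ≫ cap m (k + 1) =
    splitL m k ▷ (S m k ⊗ S m 1) ≫ nestHom (cap m 1) (cap m k) :=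
  Presented.cls_eq (P := webPresentation m) (Eqv.rel (WebRel.rotateR k))

theorem rotateR' (k : ℕ) : mergeR m k ▷ S m (k + 1) ≫ cap m (k + 1) =
    (S m k ⊗ S m 1) ◁ splitL m k ≫ nestHom (cap m k) (cap m 1) :=
  Presented.cls_eq (P := webPresentation m) (Eqv.rel (WebRel.rotateR' k))

theorem circle : cup m 1 ≫ cap m 1 = (m : ℂ) • 𝟙 _ :=
  Presented.cls_eq (P := webPresentation m) (Eqv.rel WebRel.circle)

theorem monogon : splitL m 1 ≫ cap m 1 = 0 :=
  Presented.cls_eq (P := webPresentation m) (Eqv.rel WebRel.monogon)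

theorem bigon (k : ℕ) : splitL m k ≫ mergeL m k = ((k : ℂ) + 1) • 𝟙 _ :=
  Presented.cls_eq (P := webPresentation m) (Eqv.rel (WebRel.bigon k))

theorem assoc (k : ℕ) : mergeL m k ▷ S m 1 ≫ mergeR m (k + 1) =
    (α_ _ _ _).hom ≫ S m 1 ◁ mergeR m k ≫ mergeL m (k + 1) :=
  Presented.cls_eq (P := webPresentation m) (Eqv.rel (WebRel.assoc k))

theorem ladder (k : ℕ) :
    ladderUpHom (cup m 1) (cap m (k + 1)) (mergeL m (k + 1)) (splitL m (k + 1)) =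
      ladderDownHom (cap m k) (splitL m k) (splitR m k) ≫ mergeR m 1 ≫ splitR m 1 +
        ((-1 : ℂ) • ladderDownHom (cap m k) (splitL m k) (splitR m k) +
          cap m (k + 1) ≫ cup m 1) :=
  Presented.cls_eq (P := webPresentation m) (Eqv.rel (WebRel.ladder k))

theorem ladder' (k : ℕ) :
    ladderUpHom (cup m 1) (cap m (k + 1)) (mergeL m (k + 1)) (splitL m (k + 1)) =
      ladderDownHom (cap m k) (splitL m k) (splitR m k) ≫ (mergeR m 1 ≫ splitR m 1) +
        (-ladderDownHom (cap m k) (splitL m k) (splitR m k) +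
          cap m (k + 1) ≫ cup m 1) := by
  rw [ladder, neg_one_smul]

theorem ladderDown_zero : ladderDownHom (cap m 0) (splitL m 0) (splitR m 0) = 𝟙 _ := by
  have h1 : cap m 0 = (λ_ (𝟙_ (Web m))).hom := rfl
  have h2 : splitL m 0 = (ρ_ (S m 1)).inv := rfl
  have h3 : splitR m 0 = (λ_ (S m 1)).inv := rfl
  change (ρ_ (S m 1)).inv ▷ S m 1 ≫ (S m 1 ⊗ 𝟙_ (Web m)) ◁ (λ_ (S m 1)).inv ≫ (α_ _ _ _).hom ≫
    S m 1 ◁ ((α_ _ _ _).inv ≫ (λ_ (𝟙_ (Web m))).hom ▷ S m 1 ≫ (λ_ _).hom) = 𝟙 _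
  monoidal

theorem mergeL_one : mergeL m 1 = mergeR m 1 := by
  have h : (ρ_ (S m 1)).hom ▷ S m 1 ≫ mergeR m 1 =
    (α_ _ (𝟙_ (Web m)) _).hom ≫ S m 1 ◁ (λ_ (S m 1)).hom ≫ mergeL m 1 := assoc m 0
  rw [← Category.assoc (α_ _ _ _).hom, MonoidalCategory.triangle] at h
  exact ((cancel_epi _).1 h).symm

theorem splitL_one : splitL m 1 = splitR m 1 := by
  refine pairing_injective (p := nestHom (cap m 1) (cap m 1))
    (p' := cup m 1 ⊗≫ S m 1 ◁ cup m 1 ▷ S m 1 ⊗≫ 𝟙 _) ?_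
    ((rotateR' m 1).symm.trans (Eq.trans ?_ (rotateL' m 1)))
  · rw [nestHom_eq]
    exact nestPair_zigzag (zig_reduce' (zigzagL m 1)) (zig_reduce' (zigzagL m 1))
  · rw [mergeL_one]

theorem quarter_crossing' : quarter (cap m 1) (cup m 1) (crossing m) = crossing m := by
  refine quarter_crossing (zigzagL m 1) (H := ladderUpHom (cup m 1) (cap m 1) (mergeL m 1)
    (splitL m 1)) ?_ (quarter_ladderUp (zigzagL m 1) (zigzagL m 1) (rotateR m 1) (rotateL' m 1))
  have h := ladder' m 0
  rw [ladderDown_zero, Category.id_comp] at h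
  exact h

theorem split_merge_one : splitR m 1 ≫ mergeR m 1 = 𝟙 _ + 𝟙 _ := by
  have h := bigon m 1
  rw [mergeL_one, splitL_one] at h
  rw [h, Nat.cast_one, _root_.add_smul, _root_.one_smul]

theorem crossing_braid :
    crossing m ▷ S m 1 ≫ ((α_ _ _ _).hom ≫ S m 1 ◁ crossing m ≫ (α_ _ _ _).inv) ≫
        crossing m ▷ S m 1 =
      ((α_ _ _ _).hom ≫ S m 1 ◁ crossing m ≫ (α_ _ _ _).inv) ≫ crossing m ▷ S m 1 ≫
        ((α_ _ _ _).hom ≫ S m 1 ◁ crossing m ≫ (α_ _ _ _).inv) := by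
  have r := rotateL m 1
  have r' := rotateL' m 1
  have ha := assoc m 1
  rw [mergeL_one] at r r' ha
  exact braid_relation (zigzagL m 1) r r' (split_merge_one m) ha
    (merge_split (zigzagL m 1) (zigzagR m 1) (zigzagL m 1) (zigzagR m 1) (zigzagL m 2)
      (rotateR m 1) (rotateR m 2) (rotateL' m 2) (ladder' m 1) (quarter_crossing' m)) rfl rfl

theorem crossing_involution : crossing m ≫ crossing m = 𝟙 _ := by
  have h : (mergeR m 1 ≫ splitR m 1) ≫ mergeR m 1 ≫ splitR m 1 =
      mergeR m 1 ≫ splitR m 1 + mergeR m 1 ≫ splitR m 1 := by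
    rw [Category.assoc, ← Category.assoc (splitR m 1), split_merge_one]; simp
  rw [crossing, Preadditive.sub_comp, Preadditive.comp_sub, Preadditive.comp_sub, h]
  simp

theorem crossing_untwist : crossing m ≫ cap m 1 = cap m 1 := by
  rw [crossing, Preadditive.sub_comp, Category.assoc, ← splitL_one, monogon]; simp

theorem crossing_slide :
    crossing m ▷ S m 1 ≫ (α_ _ _ _).hom ≫ S m 1 ◁ cap m 1 ≫ (ρ_ _).hom =
      ((α_ _ _ _).hom ≫ S m 1 ◁ crossing m ≫ (α_ _ _ _).inv) ≫ cap m 1 ▷ S m 1 ≫ (λ_ _).hom :=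
  slide_of_quarter (zigzagR m 1) (quarter_crossing' m)

/-- The images of the generating morphisms of the Brauer category. -/
def ofBrauerGen : ∀ {x y : Word Unit}, BrauerGen x y →
    (Presented.wordValue (fun _ => S m 1) x ⟶ Presented.wordValue (fun _ => S m 1) y)
  | _, _, BrauerGen.cross => crossing m
  | _, _, BrauerGen.cap => cap m 1
  | _, _, BrauerGen.cup => cup m 1

theorem ofBrauerGen_rel {x y : Word Unit} {f g : Term BrauerGen x y} (h : BrauerRel m f g) :
    Presented.exprValue (fun _ => S m 1) (ofBrauerGen m) f =
      Presented.exprValue (fun _ => S m 1) (ofBrauerGen m) g := by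
  cases h with
  | zigzagL => exact zigzagL m 1
  | zigzagR => exact zigzagR m 1
  | involution => exact crossing_involution m
  | braid => exact crossing_braid m
  | untwist => exact crossing_untwist m
  | slide => exact crossing_slide m
  | circle => exact circle m

end Web

section symmetric

variable {M : Type*} [Monoid M]

/-- The product of consecutive Coxeter generators carrying `o` to `o + j`. -/
def cosetRep (g : ℕ → M) (o : ℕ) : ℕ → M
  | 0 => 1
  | j + 1 => g (o + j) * cosetRep g o j

theorem cosetRep_comm {g : ℕ → M} {n : ℕ}
    (hf : ∀ i j, i + 2 ≤ j → j < n → g i * g j = g j * g i) (o : ℕ) {i : ℕ} (hi : i < n) :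
    ∀ j, o + j < i → g i * cosetRep g o j = cosetRep g o j * g i
  | 0, _ => by simp [cosetRep]
  | j + 1, h => by
    rw [cosetRep, ← mul_assoc, ← hf (o + j) i (by omega) hi, mul_assoc,
      cosetRep_comm hf o hi j (by omega), mul_assoc]

theorem cosetRep_shift {g : ℕ → M} {n : ℕ}
    (hb : ∀ i, i + 1 < n → g i * g (i + 1) * g i = g (i + 1) * g i * g (i + 1))
    (hf : ∀ i j, i + 2 ≤ j → j < n → g i * g j = g j * g i) (o : ℕ) {i : ℕ} (ho : o ≤ i) :
    ∀ j, i + 1 < o + j → o + j ≤ n → g i * cosetRep g o j = cosetRep g o j * g (i + 1)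
  | 0, h, _ => by omega
  | j + 1, h, hj => by
    rcases Nat.lt_or_ge (i + 1) (o + j) with h' | h'
    · rw [cosetRep, ← mul_assoc, hf i (o + j) (by omega) (by omega), mul_assoc,
        cosetRep_shift hb hf o ho j h' (by omega), mul_assoc]
    · obtain ⟨j, rfl⟩ : ∃ l, j = l + 1 := ⟨j - 1, by omega⟩
      obtain rfl : i = o + j := by omega
      rw [cosetRep, cosetRep, ← mul_assoc, ← mul_assoc, ← Nat.add_assoc, hb _ (by omega), mul_assoc,
        cosetRep_comm hf o (by omega) j (by omega), mul_assoc, mul_assoc, mul_assoc]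

open Equiv in
/-- A Coxeter generator together with the corresponding transposition. -/
def pairGen (c : ℕ → M) (i : ℕ) : M × Perm ℕ := (c i, swap i (i + 1))

/-- The submonoid generated by the Coxeter generators in a range, paired with transpositions. -/
def pairSub (c : ℕ → M) (n o : ℕ) : Submonoid (M × Equiv.Perm ℕ) :=
  Submonoid.closure {x | ∃ i, o ≤ i ∧ i < n ∧ x = pairGen c i}

theorem swap_comm_far {i j : ℕ} (h : i + 2 ≤ j) :
    Equiv.swap i (i + 1) * Equiv.swap j (j + 1) = Equiv.swap j (j + 1) * Equiv.swap i (i + 1) := by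
  ext x
  simp only [Equiv.Perm.mul_apply, Equiv.swap_apply_def]
  grind

theorem swap_braid (i : ℕ) :
    Equiv.swap i (i + 1) * Equiv.swap (i + 1) (i + 1 + 1) * Equiv.swap i (i + 1) =
      Equiv.swap (i + 1) (i + 1 + 1) * Equiv.swap i (i + 1) * Equiv.swap (i + 1) (i + 1 + 1) := by
  ext x
  simp only [Equiv.Perm.mul_apply, Equiv.swap_apply_def]
  grind

variable {c : ℕ → M} {n : ℕ}

theorem pairSub_fix {o : ℕ} {x : M × Equiv.Perm ℕ} (hx : x ∈ pairSub c n o) :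
    ∀ a < o, x.2 a = a := by
  induction hx using Submonoid.closure_induction with
  | mem x h =>
    obtain ⟨i, hi, _, rfl⟩ := h
    intro a ha
    exact Equiv.swap_apply_of_ne_of_ne (by omega) (by omega)
  | one => intro a _; rfl
  | mul x y _ _ hx hy => intro a ha; rw [Prod.snd_mul, Equiv.Perm.mul_apply, hy a ha, hx a ha]

theorem cosetRep_apply (o : ℕ) : ∀ j, (cosetRep (pairGen c) o j).2 o = o + j
  | 0 => rfl
  | j + 1 => by
    rw [cosetRep, Prod.snd_mul, Equiv.Perm.mul_apply, cosetRep_apply o j]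
    exact Equiv.swap_apply_left _ _

theorem pairGen_sq (h2 : ∀ i, i < n → c i * c i = 1) : ∀ i, i < n → pairGen c i * pairGen c i = 1 := fun i hi =>
  Prod.ext (h2 i hi) (Equiv.swap_mul_self _ _)

theorem pairSub_inv (h2 : ∀ i, i < n → c i * c i = 1) {x : M × Equiv.Perm ℕ}
    (hx : x ∈ pairSub c n 0) :
    ∃ y ∈ pairSub c n 0, y * x = 1 ∧ x * y = 1 := by
  induction hx using Submonoid.closure_induction with
  | mem x h =>
    obtain ⟨i, hi, hi', rfl⟩ := h
    exact ⟨_, Submonoid.subset_closure ⟨i, hi, hi', rfl⟩, pairGen_sq h2 i hi', pairGen_sq h2 i hi'⟩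
  | one => exact ⟨1, one_mem _, by simp, by simp⟩
  | mul x y _ _ hx hy =>
    obtain ⟨x', h, h1, h2⟩ := hx
    obtain ⟨y', h', h1', h2'⟩ := hy
    refine ⟨y' * x', mul_mem h' h, ?_, ?_⟩
    · rw [mul_assoc, ← mul_assoc x', h1, one_mul, h1']
    · rw [mul_assoc, ← mul_assoc y, h2', one_mul, h2]

theorem pairSub_normal (h2 : ∀ i, i < n → c i * c i = 1)
    (hb : ∀ i, i + 1 < n → c i * c (i + 1) * c i = c (i + 1) * c i * c (i + 1))
    (hf : ∀ i j, i + 2 ≤ j → j < n → c i * c j = c j * c i)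
    {o : ℕ} {x : M × Equiv.Perm ℕ} (ho : o ≤ n) (hx : x ∈ pairSub c n o) :
    ∃ j, o + j ≤ n ∧ ∃ y ∈ pairSub c n (o + 1), x = cosetRep (pairGen c) o j * y := by
  have hb' : ∀ i, i + 1 < n → pairGen c i * pairGen c (i + 1) * pairGen c i =
      pairGen c (i + 1) * pairGen c i * pairGen c (i + 1) := fun i hi =>
    Prod.ext (hb i hi) (swap_braid i)
  have hf' : ∀ i j, i + 2 ≤ j → j < n → pairGen c i * pairGen c j = pairGen c j * pairGen c i :=
    fun i j h h' => Prod.ext (hf i j h h') (swap_comm_far h)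
  induction hx using Submonoid.closure_induction_left with
  | one => exact ⟨0, ho, 1, one_mem _, by simp [cosetRep]⟩
  | mul_left x hx y _ ih =>
    obtain ⟨i, hi, hi', rfl⟩ := hx
    obtain ⟨j, hj, y, hy, rfl⟩ := ih
    rcases lt_trichotomy i (o + j) with h | h | h
    · obtain ⟨j, rfl⟩ : ∃ l, j = l + 1 := ⟨j - 1, by omega⟩
      rcases Nat.lt_or_ge i (o + j) with h' | h'
      · refine ⟨j + 1, hj, pairGen c (i + 1) * y,
          mul_mem (Submonoid.subset_closure ⟨i + 1, by omega, by omega, rfl⟩) hy, ?_⟩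
        rw [← mul_assoc, cosetRep_shift hb' hf' o hi (j + 1) (by omega) hj, mul_assoc]
      · obtain rfl : i = o + j := by omega
        refine ⟨j, by omega, y, hy, ?_⟩
        rw [cosetRep, ← mul_assoc, ← mul_assoc, pairGen_sq h2 _ hi', one_mul]
    · subst h
      exact ⟨j + 1, by omega, y, hy, by rw [cosetRep, mul_assoc]⟩
    · refine ⟨j, hj, pairGen c i * y,
        mul_mem (Submonoid.subset_closure ⟨i, by omega, by omega, rfl⟩) hy, ?_⟩
      rw [← mul_assoc, cosetRep_comm hf' o hi' j h, mul_assoc]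

theorem pairSub_eq_one (h2 : ∀ i, i < n → c i * c i = 1)
    (hb : ∀ i, i + 1 < n → c i * c (i + 1) * c i = c (i + 1) * c i * c (i + 1))
    (hf : ∀ i j, i + 2 ≤ j → j < n → c i * c j = c j * c i) :
    ∀ (d o : ℕ), o + d = n → ∀ x ∈ pairSub c n o, x.2 = 1 → x.1 = 1
  | 0, o, ho, x, hx, _ => by
    have : {x | ∃ i, o ≤ i ∧ i < n ∧ x = pairGen c i} = (∅ : Set (M × Equiv.Perm ℕ)) := by
      ext x
      simp only [Set.mem_ofPred_eq, Set.mem_empty_iff_false, iff_false]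
      rintro ⟨i, h, h', _⟩
      omega
    rw [pairSub, this, Submonoid.closure_empty, Submonoid.mem_bot] at hx
    rw [hx]; rfl
  | d + 1, o, ho, x, hx, h => by
    obtain ⟨j, hj, y, hy, rfl⟩ := pairSub_normal h2 hb hf (by omega) hx
    have h1 := DFunLike.congr_fun h o
    rw [Prod.snd_mul, Equiv.Perm.mul_apply, pairSub_fix hy o (by omega), cosetRep_apply,
      Equiv.Perm.one_apply] at h1
    obtain rfl : j = 0 := by omega
    rw [cosetRep, one_mul] at h ⊢
    exact pairSub_eq_one h2 hb hf d (o + 1) (by omega) y hy h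

theorem pairSub_unique (h2 : ∀ i, i < n → c i * c i = 1)
    (hb : ∀ i, i + 1 < n → c i * c (i + 1) * c i = c (i + 1) * c i * c (i + 1))
    (hf : ∀ i j, i + 2 ≤ j → j < n → c i * c j = c j * c i)
    {x y : M × Equiv.Perm ℕ} (hx : x ∈ pairSub c n 0) (hy : y ∈ pairSub c n 0)
    (h : x.2 = y.2) : x.1 = y.1 := by
  obtain ⟨z, hz, h1, h3⟩ := pairSub_inv h2 hy
  have h4 : (z * x).1 = 1 := by
    refine pairSub_eq_one h2 hb hf n 0 (by omega) _ (mul_mem hz hx) ?_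
    rw [Prod.snd_mul, h, ← Prod.snd_mul, h1]; rfl
  calc x.1 = (y * z).1 * x.1 := by rw [h3]; simp
    _ = y.1 * (z * x).1 := by rw [Prod.fst_mul, Prod.fst_mul, mul_assoc]
    _ = y.1 := by rw [h4, mul_one]

/-- The Coxeter presentation of the symmetric group on `n + 1` letters. -/
theorem exists_permHom_succ (h2 : ∀ i, i < n → c i * c i = 1)
    (hb : ∀ i, i + 1 < n → c i * c (i + 1) * c i = c (i + 1) * c i * c (i + 1))
    (hf : ∀ i j, i + 2 ≤ j → j < n → c i * c j = c j * c i) :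
    ∃ ρ : Equiv.Perm (Fin (n + 1)) →* M, ∀ i : Fin n, ρ (Equiv.swap i.castSucc i.succ) = c i := by
  let v : Equiv.Perm (Fin (n + 1)) →* Equiv.Perm ℕ :=
    Equiv.Perm.viaEmbeddingHom Fin.valEmbedding
  have hv : ∀ i : Fin n, v (Equiv.swap i.castSucc i.succ) = Equiv.swap (i : ℕ) (i + 1) := by
    intro i
    ext x
    rcases Nat.lt_or_ge x (n + 1) with hx | hx
    · refine (Equiv.Perm.viaEmbedding_apply _ Fin.valEmbedding (⟨x, hx⟩ : Fin (n + 1))).trans ?_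
      simp only [Fin.valEmbedding_apply, Equiv.swap_apply_def, Fin.ext_iff, Fin.val_castSucc,
        Fin.val_succ]
      split_ifs <;> simp
    · refine (Equiv.Perm.viaEmbedding_apply_of_notMem _ _ x ?_).trans ?_
      · rintro ⟨y, rfl⟩
        have := y.2
        simp at hx
        omega
      · rw [Equiv.swap_apply_of_ne_of_ne] <;> omega
  have hex : ∀ w : Equiv.Perm (Fin (n + 1)), ∃ x ∈ pairSub c n 0, x.2 = v w := by
    intro w
    have hw : w ∈ Submonoid.closure
        (Set.range fun i : Fin n => Equiv.swap i.castSucc i.succ) := by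
      rw [Equiv.Perm.mclosure_swap_castSucc_succ]; trivial
    induction hw using Submonoid.closure_induction with
    | mem w h =>
      obtain ⟨i, rfl⟩ := h
      exact ⟨pairGen c i, Submonoid.subset_closure ⟨i, Nat.zero_le _, i.2, rfl⟩, (hv i).symm⟩
    | one => exact ⟨1, one_mem _, by simp⟩
    | mul w w' _ _ h h' =>
      obtain ⟨x, hx, hx'⟩ := h
      obtain ⟨y, hy, hy'⟩ := h'
      exact ⟨x * y, mul_mem hx hy, by rw [Prod.snd_mul, hx', hy', map_mul]⟩
  choose f hf1 hf2 using hex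
  refine ⟨⟨⟨fun w => (f w).1, ?_⟩, ?_⟩, ?_⟩
  · exact pairSub_unique h2 hb hf (hf1 1) (one_mem _) (by rw [hf2, map_one]; rfl)
  · intro w w'
    exact pairSub_unique h2 hb hf (hf1 _) (mul_mem (hf1 w) (hf1 w'))
      (by rw [hf2, map_mul, Prod.snd_mul, hf2, hf2])
  · intro i
    exact pairSub_unique h2 hb hf (y := pairGen c i) (hf1 _)
      (Submonoid.subset_closure ⟨i, Nat.zero_le _, i.2, rfl⟩) (by rw [hf2, hv]; rfl)

/-- The Coxeter presentation of the symmetric group on `k` letters. -/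
theorem exists_permHom (k : ℕ) (c : ℕ → M) (h2 : ∀ i, i + 1 < k → c i * c i = 1)
    (hb : ∀ i, i + 2 < k → c i * c (i + 1) * c i = c (i + 1) * c i * c (i + 1))
    (hf : ∀ i j, i + 2 ≤ j → j + 1 < k → c i * c j = c j * c i) :
    ∃ ρ : Equiv.Perm (Fin k) →* M, ∀ (i : ℕ) (hi : i + 1 < k),
      ρ (Equiv.swap ⟨i, Nat.lt_of_succ_lt hi⟩ ⟨i + 1, hi⟩) = c i := by
  cases k with
  | zero => exact ⟨1, fun i hi => absurd hi (by omega)⟩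
  | succ n =>
    obtain ⟨ρ, h⟩ := exists_permHom_succ (n := n) (c := c) (fun i hi => h2 i (by omega))
      (fun i hi => hb i (by omega)) (fun i j h h' => hf i j h (by omega))
    exact ⟨ρ, fun i hi => h ⟨i, by omega⟩⟩

end symmetric

section tower

universe v u

variable {D : Type u} [Category.{v} D] [MonoidalCategory D]

/-- The crossing of the last two strands. -/
def lastPair (A : D) {V : D} (X : V ⊗ V ⟶ V ⊗ V) : (A ⊗ V) ⊗ V ⟶ (A ⊗ V) ⊗ V :=
  (α_ _ _ _).hom ≫ A ◁ X ≫ (α_ _ _ _).inv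

theorem lastPair_sq (A : D) {V : D} {X : V ⊗ V ⟶ V ⊗ V} (h : X ≫ X = 𝟙 _) :
    lastPair A X ≫ lastPair A X = 𝟙 _ := by
  have : lastPair A X ≫ lastPair A X = (α_ _ _ _).hom ≫ A ◁ (X ≫ X) ≫ (α_ _ _ _).inv := by
    simp only [lastPair]; monoidal
  rw [this, h]; monoidal

theorem lastPair_comm {A V : D} {X : V ⊗ V ⟶ V ⊗ V} (f : A ⟶ A) :
    f ▷ V ▷ V ≫ lastPair A X = lastPair A X ≫ f ▷ V ▷ V := by
  have h1 : f ▷ V ▷ V ≫ lastPair A X =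
      (α_ _ _ _).hom ≫ (f ▷ (V ⊗ V) ≫ A ◁ X) ≫ (α_ _ _ _).inv := by
    simp only [lastPair]; monoidal
  rw [h1, ← whisker_exchange]
  simp only [lastPair]; monoidal

theorem lastPair_braid (A : D) {V : D} {X : V ⊗ V ⟶ V ⊗ V}
    (h : X ▷ V ≫ ((α_ _ _ _).hom ≫ V ◁ X ≫ (α_ _ _ _).inv) ≫ X ▷ V =
      ((α_ _ _ _).hom ≫ V ◁ X ≫ (α_ _ _ _).inv) ≫ X ▷ V ≫
        ((α_ _ _ _).hom ≫ V ◁ X ≫ (α_ _ _ _).inv)) :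
    lastPair A X ▷ V ≫ lastPair (A ⊗ V) X ≫ lastPair A X ▷ V =
      lastPair (A ⊗ V) X ≫ lastPair A X ▷ V ≫ lastPair (A ⊗ V) X := by
  calc _ = 𝟙 _ ⊗≫ A ◁ (X ▷ V ≫ ((α_ _ _ _).hom ≫ V ◁ X ≫ (α_ _ _ _).inv) ≫ X ▷ V) ⊗≫ 𝟙 _ := by
        simp only [lastPair]; monoidal
    _ = _ := by rw [h]; simp only [lastPair]; monoidal

end tower

/-- The word with `k` letters. -/
def ones : ℕ → Word Unit
  | 0 => Word.unit
  | k + 1 => Word.tensor (ones k) pt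

namespace Brauer

variable (m : ℕ)

/-- The object `•^{⊗ k}` of the Brauer category. -/
abbrev P (k : ℕ) : Brauer m := Presented.ofWord (ones k)

/-- The object `•` of the Brauer category. -/
abbrev V : Brauer m := Presented.ofWord pt

/-- The crossing of the Brauer category. -/
def crossing : V m ⊗ V m ⟶ V m ⊗ V m :=
  Presented.cls (P := brauerPresentation m) BrauerTerm.cross

theorem crossing_sq : crossing m ≫ crossing m = 𝟙 _ :=
  Presented.cls_eq (P := brauerPresentation m) (Eqv.rel BrauerRel.involution)

theorem crossing_braid :
    crossing m ▷ V m ≫ ((α_ _ _ _).hom ≫ V m ◁ crossing m ≫ (α_ _ _ _).inv) ≫ crossing m ▷ V m =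
      ((α_ _ _ _).hom ≫ V m ◁ crossing m ≫ (α_ _ _ _).inv) ≫ crossing m ▷ V m ≫
        ((α_ _ _ _).hom ≫ V m ◁ crossing m ≫ (α_ _ _ _).inv) :=
  Presented.cls_eq (P := brauerPresentation m) (Eqv.rel BrauerRel.braid)

/-- The crossing of the strands in positions `i` and `i + 1` (counted from `0`) out of `k` strands;
only meaningful for `i + 1 < k`. -/
def crossAt : ∀ k : ℕ, ℕ → (P m k ⟶ P m k)
  | 0, _ => 𝟙 _
  | 1, _ => 𝟙 _
  | k + 2, i => if i = k then lastPair (P m k) (crossing m) else crossAt (k + 1) i ▷ V m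

theorem crossAt_last (k : ℕ) : crossAt m (k + 2) k = lastPair (P m k) (crossing m) := if_pos rfl

theorem crossAt_of_lt {k i : ℕ} (h : i < k) : crossAt m (k + 2) i = crossAt m (k + 1) i ▷ V m :=
  if_neg h.ne

theorem crossAt_sq : ∀ (k i : ℕ), i + 1 < k → crossAt m k i ≫ crossAt m k i = 𝟙 _
  | 0, _, h => by omega
  | 1, _, h => by omega
  | k + 2, i, h => by
    rcases Nat.lt_or_ge i k with hi | hi
    · rw [crossAt_of_lt m hi]
      have h := congrArg (· ▷ V m) (crossAt_sq (k + 1) i (by omega))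
      simp only [comp_whiskerRight, id_whiskerRight] at h
      exact h
    · obtain rfl : i = k := by omega
      rw [crossAt_last]
      exact lastPair_sq _ (crossing_sq m)

theorem crossAt_braid : ∀ (k i : ℕ), i + 2 < k →
    crossAt m k i ≫ crossAt m k (i + 1) ≫ crossAt m k i =
      crossAt m k (i + 1) ≫ crossAt m k i ≫ crossAt m k (i + 1)
  | 0, _, h => by omega
  | 1, _, h => by omega
  | 2, _, h => by omega
  | k + 3, i, h => by
    rcases Nat.lt_or_ge i k with hi | hi
    · rw [crossAt_of_lt m (show i < k + 1 by omega),
        crossAt_of_lt m (show i + 1 < k + 1 by omega)]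
      have h := congrArg (· ▷ V m) (crossAt_braid (k + 2) i (by omega))
      simp only [comp_whiskerRight] at h
      exact h
    · obtain rfl : i = k := by omega
      rw [crossAt_of_lt m (show i < i + 1 by omega), crossAt_last, crossAt_last]
      exact lastPair_braid _ (crossing_braid m)

theorem crossAt_comm : ∀ (k i j : ℕ), i + 2 ≤ j → j + 1 < k →
    crossAt m k i ≫ crossAt m k j = crossAt m k j ≫ crossAt m k i
  | 0, _, _, _, h => by omega
  | 1, _, _, _, h => by omega
  | k + 2, i, j, h, h' => by
    rw [crossAt_of_lt m (show i < k by omega)]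
    rcases Nat.lt_or_ge j k with hj | hj
    · rw [crossAt_of_lt m hj]
      have h := congrArg (· ▷ V m) (crossAt_comm (k + 1) i j h (by omega))
      simp only [comp_whiskerRight] at h
      exact h
    · obtain rfl : j = k := by omega
      obtain ⟨j, rfl⟩ : ∃ l, j = l + 1 := ⟨j - 1, by omega⟩
      rw [crossAt_last, crossAt_of_lt m (show i < j by omega)]
      exact lastPair_comm _

theorem exists_perm (k : ℕ) : ∃ ρ : Equiv.Perm (Fin k) →* End (P m k),
    ∀ (i : ℕ) (hi : i + 1 < k),
      ρ (Equiv.swap ⟨i, Nat.lt_of_succ_lt hi⟩ ⟨i + 1, hi⟩) = crossAt m k i :=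
  exists_permHom (M := End (P m k)) k (crossAt m k) (crossAt_sq m k)
    (fun i hi => (Category.assoc _ _ _).symm.trans ((Category.assoc _ _ _).trans
      ((crossAt_braid m k i hi).trans rfl)))
    (fun i j h h' => (crossAt_comm m k i j h h').symm)

/-- The homomorphism from the symmetric group to the endomorphisms of `•^{⊗ k}` which sends the
transposition of `i` and `i + 1` to the crossing of the strands in these positions. As these
transpositions generate the symmetric group, it is unique. -/
noncomputable def perm (k : ℕ) : Equiv.Perm (Fin k) →* End (P m k) := (exists_perm m k).choose

theorem perm_swap (k i : ℕ) (hi : i + 1 < k) :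
    perm m k (Equiv.swap ⟨i, Nat.lt_of_succ_lt hi⟩ ⟨i + 1, hi⟩) = crossAt m k i :=
  (exists_perm m k).choose_spec i hi

/-- The sum of all permutations of `k` strands, weighted by their signs. -/
noncomputable def signedSum (k : ℕ) : P m k ⟶ P m k :=
  ∑ w : Equiv.Perm (Fin k), ((Equiv.Perm.sign w : ℤ) : ℂ) • (perm m k w : P m k ⟶ P m k)

/-- The antisymmetrizer on `k` strands. -/
noncomputable def antisymmetrizer (k : ℕ) : P m k ⟶ P m k :=
  ((k.factorial : ℂ)⁻¹) • signedSum m k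

end Brauer

/-- The objects of the standard web category: tensor products of copies of the object `1`. -/
inductive IsStd (m : ℕ) : ObjectProperty (Web m)
  | unit : IsStd m (𝟙_ (Web m))
  | one : IsStd m (Web.S m 1)
  | tensor {X Y : Web m} : IsStd m X → IsStd m Y → IsStd m (X ⊗ Y)

instance (m : ℕ) : (IsStd m).IsMonoidal where
  prop_unit := IsStd.unit
  prop_tensor _ _ := IsStd.tensor

/-- The standard web category: the full monoidal subcategory of the web category generated by the
object `1`. -/
abbrev StdWeb (m : ℕ) := (IsStd m).FullSubcategory

theorem isStd_wordValue (m : ℕ) : ∀ w : Word Unit,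
    IsStd m (Presented.wordValue (fun _ => Web.S m 1) w)
  | Word.unit => IsStd.unit
  | Word.of _ => IsStd.one
  | Word.tensor x y => IsStd.tensor (isStd_wordValue m x) (isStd_wordValue m y)

/-- The strict monoidal `ℂ`-linear functor from the Brauer category to the standard web category
which sends the object `•` to `1`, and the crossing, cap and cup to the crossing, cap and cup. -/
def eta (m : ℕ) : Brauer m ⥤ StdWeb m :=
  (IsStd m).lift (Presented.lift (P := brauerPresentation m) (fun _ => Web.S m 1) (Web.ofBrauerGen m)
    (Web.ofBrauerGen_rel m)) (fun X => isStd_wordValue m X.word)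

namespace StdWeb

variable (m : ℕ)

/-- The object `1^{⊗ k}` of the standard web category. -/
abbrev P (k : ℕ) : StdWeb m := (eta m).obj (Brauer.P m k)

/-- The web merging `k` strands labelled `1`, one at a time from the left, into a strand
labelled `k`. -/
def mergeAll : ∀ k : ℕ, (P m k).obj ⟶ Web.S m k
  | 0 => 𝟙 _
  | k + 1 => mergeAll k ▷ Web.S m 1 ≫ Web.mergeR m k

/-- The web splitting a strand labelled `k` into `k` strands labelled `1`, the mirror image of the
web merging them. -/
def splitAll : ∀ k : ℕ, Web.S m k ⟶ (P m k).obj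
  | 0 => 𝟙 _
  | k + 1 => Web.splitR m k ≫ splitAll k ▷ Web.S m 1

/-- The web merging `k` strands labelled `1` into a strand labelled `k` and splitting them again. -/
def mergeSplit (k : ℕ) : P m k ⟶ P m k := ObjectProperty.homMk (mergeAll m k ≫ splitAll m k)

end StdWeb

end OWeb

/-! Both sides obey the same recursion in the number of strands, and agree for `k = 0` and `k = 1`.
With `J` standing for either side on `k + 1` strands, `J'` for the same side on `k + 2` strands, and
`X` for the crossing of the last two strands, the recursion reads `J' = J ▷ V - (1 / k!) • (J ▷ V ≫
X ≫ J ▷ V)`.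

For signed sums this is a fact about symmetric groups (`signSum_succ_succ`). Let `A` be the signed
sum over the permutations fixing the last letter. Splitting the whole group into cosets gives `A`
minus the sum of all `A * (j last)`. On the other hand, in `A * s * A`, with `s` the last simple
transposition, every summand of the right-hand `A` can be moved to the left through `s`: it
conjugates `s` into some `(j last)`, and its sign cancels when it is absorbed by `A`. Each `j`
arises `k!` times, so `A * s * A` is `k!` times the sum of the `A * (j last)`.

For webs the recursion comes from the ladder relation. Rotated by a quarter turn, that relation
becomes a formula for merging a thick strand with a thin one and splitting them again: the identity
minus a crossing placed between a split and a merge (`Web.merge_split_succ`). Inserted in the middle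
of the web on `k + 2` strands, it yields two terms. The first is already `J ▷ V`; the second becomes
`J ▷ V ≫ X ≫ J ▷ V` once the missing merges and splits of `k` strands are supplied
(`merge_split_recursion`). Supplying them costs factors of `k!`, because splitting a strand labelled
`k` completely and merging it back is multiplication by `k!` (`StdWeb.splitAll_mergeAll`). -/

namespace OWeb

/-! ### Signed sums over symmetric groups -/

section signedSum

open Equiv

/-- Extending a permutation of `n` letters by a fixed last letter. -/
noncomputable def permCastSucc (n : ℕ) : Perm (Fin n) →* Perm (Fin (n + 1)) :=
  Perm.viaEmbeddingHom Fin.castSuccEmb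

theorem permCastSucc_castSucc {n : ℕ} (w : Perm (Fin n)) (x : Fin n) :
    permCastSucc n w x.castSucc = (w x).castSucc :=
  Perm.viaEmbedding_apply w Fin.castSuccEmb x

theorem permCastSucc_last {n : ℕ} (w : Perm (Fin n)) :
    permCastSucc n w (Fin.last n) = Fin.last n := by
  refine Perm.viaEmbedding_apply_of_notMem w Fin.castSuccEmb _ ?_
  rintro ⟨x, hx⟩
  exact (Fin.castSucc_lt_last x).ne hx

theorem sign_permCastSucc {n : ℕ} (w : Perm (Fin n)) :
    Perm.sign (permCastSucc n w) = Perm.sign w := by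
  rw [permCastSucc, Perm.viaEmbeddingHom_apply, Perm.viaEmbedding]
  convert! Perm.sign_extendDomain w _

theorem permCastSucc_injective (n : ℕ) : Function.Injective (permCastSucc n) :=
  Perm.viaEmbeddingHom_injective _

theorem permCastSucc_swap {n : ℕ} (x y : Fin n) :
    permCastSucc n (swap x y) = swap x.castSucc y.castSucc := by
  ext z
  induction z using Fin.lastCases with
  | last =>
    rw [permCastSucc_last, swap_apply_of_ne_of_ne (Fin.castSucc_lt_last x).ne'
      (Fin.castSucc_lt_last y).ne']
  | cast z =>
    rw [permCastSucc_castSucc, swap_apply_def, swap_apply_def]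
    simp only [Fin.castSucc_inj]
    split_ifs <;> rfl

/-- Representatives of the cosets of the permutations fixing the last letter. -/
def lastSwap (n : ℕ) : Option (Fin n) → Perm (Fin (n + 1))
  | none => 1
  | some j => swap j.castSucc (Fin.last n)

/-- The coset of a permutation modulo the stabilizer of the last letter is determined by which
letter it sends to the last one. -/
theorem permCastSucc_mul_lastSwap_bijective (n : ℕ) :
    Function.Bijective fun p : Option (Fin n) × Perm (Fin n) =>
      permCastSucc n p.2 * lastSwap n p.1 := by
  -- The left factor fixes the last letter, so the representative alone decides which letter lands
  -- there; this recovers `o` from the product.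
  have key : ∀ (o : Option (Fin n)) (w : Perm (Fin n)) (j : Fin n),
      (permCastSucc n w * lastSwap n o) j.castSucc = Fin.last n ↔ o = some j := by
    intro o w j
    cases o with
    | none =>
      simp only [lastSwap, mul_one, permCastSucc_castSucc, reduceCtorEq, iff_false]
      exact (Fin.castSucc_lt_last _).ne
    | some i =>
      simp only [lastSwap, Perm.mul_apply, Option.some.injEq]
      by_cases h : i = j
      · subst h
        simp [permCastSucc_last]
      · rw [swap_apply_of_ne_of_ne (by simpa using Ne.symm h) (Fin.castSucc_lt_last _).ne,
          permCastSucc_castSucc]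
        exact iff_of_false (Fin.castSucc_lt_last _).ne h
  rw [Fintype.bijective_iff_injective_and_card]
  constructor
  · rintro ⟨o, w⟩ ⟨o', w'⟩ h
    have ho : o = o' := by
      ext j
      rw [← key o w j, ← key o' w' j]
      exact iff_of_eq (congrArg (fun t : Perm (Fin (n + 1)) => t j.castSucc = Fin.last n) h)
    subst ho
    exact congrArg _ (permCastSucc_injective n (mul_right_cancel h))
  -- The count is `(n + 1) * n! = (n + 1)!`.
  · simp [Fintype.card_perm, Nat.factorial_succ]

variable {R : Type*} [Ring R] [Algebra ℂ R]

/-- The sum of the images of all permutations, weighted by their signs. -/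
noncomputable def signSum {n : ℕ} (ρ : Perm (Fin n) →* R) : R :=
  ∑ w : Perm (Fin n), ((Perm.sign w : ℤ) : ℂ) • ρ w

theorem sign_mul_self_cast {n : ℕ} (w : Perm (Fin n)) :
    ((Perm.sign w : ℤ) : ℂ) * ((Perm.sign w : ℤ) : ℂ) = 1 := by
  rcases Int.units_eq_one_or (Perm.sign w) with h | h <;> simp [h]

/-- Right translation by `v` permutes the summands and multiplies every sign by that of `v`, which
is its own inverse. -/
theorem signSum_mul {n : ℕ} (ρ : Perm (Fin n) →* R) (v : Perm (Fin n)) :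
    signSum ρ * ρ v = ((Perm.sign v : ℤ) : ℂ) • signSum ρ := by
  rw [signSum, Finset.sum_mul, Finset.smul_sum]
  refine Fintype.sum_equiv (Equiv.mulRight v) _ _ fun w => ?_
  rw [Equiv.coe_mulRight, map_mul, map_mul, smul_mul_assoc, smul_smul, Units.val_mul, Int.cast_mul,
    mul_comm (((Perm.sign w : ℤ) : ℂ)), ← mul_assoc, sign_mul_self_cast, one_mul]

/-- This is the coset decomposition: the trivial coset contributes with sign `+`, and each of the
others with sign `-`, its representative being a transposition. -/
theorem signSum_succ {n : ℕ} (ρ : Perm (Fin (n + 1)) →* R) :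
    signSum ρ = signSum (ρ.comp (permCastSucc n)) -
      ∑ j : Fin n, signSum (ρ.comp (permCastSucc n)) * ρ (swap j.castSucc (Fin.last n)) := by
  rw [signSum, ← (Equiv.ofBijective _ (permCastSucc_mul_lastSwap_bijective n)).sum_comp,
    Fintype.sum_prod_type, Fintype.sum_option, sub_eq_add_neg, ← Finset.sum_neg_distrib]
  refine congrArg₂ _ ?_ (Finset.sum_congr rfl fun j _ => ?_)
  · refine Finset.sum_congr rfl fun w _ => ?_
    simp [lastSwap, sign_permCastSucc]
  · rw [signSum, Finset.sum_mul, ← Finset.sum_neg_distrib]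
    refine Finset.sum_congr rfl fun w _ => ?_
    simp [lastSwap, sign_permCastSucc, Perm.sign_swap (Fin.castSucc_lt_last j).ne]


/-- Sums over permutations of a function of the value at one letter. -/
theorem sum_perm_apply {k : ℕ} {E : Type*} [AddCommMonoid E] (f : Fin (k + 1) → E)
    (i : Fin (k + 1)) :
    ∑ w : Perm (Fin (k + 1)), f (w i) = k.factorial • ∑ j, f j := by
  -- Translating by a transposition moves the chosen letter to `0`, where `decomposeFin` separates
  -- the value at `0` from the remaining `k!` choices.
  have h0 : ∑ w : Perm (Fin (k + 1)), f (w i) = ∑ w : Perm (Fin (k + 1)), f (w 0) := by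
    refine Fintype.sum_equiv (Equiv.mulRight (swap 0 i)) _ _ fun w => ?_
    simp
  rw [h0, ← Perm.decomposeFin.symm.sum_comp, Fintype.sum_prod_type, Finset.smul_sum]
  refine Finset.sum_congr rfl fun j _ => ?_
  simp [Fintype.card_perm]

/-- The sum over the double coset of the last simple transposition. -/
theorem signSum_succ_succ {k : ℕ} (ρ : Perm (Fin (k + 2)) →* R) :
    signSum ρ = signSum (ρ.comp (permCastSucc (k + 1))) - ((k.factorial : ℂ)⁻¹) •
      (signSum (ρ.comp (permCastSucc (k + 1))) *
        (ρ (swap (Fin.last k).castSucc (Fin.last (k + 1))) *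
          signSum (ρ.comp (permCastSucc (k + 1))))) := by
  set A := signSum (ρ.comp (permCastSucc (k + 1))) with hA
  -- One summand of the right-hand `A` is carried leftwards through the last simple transposition.
  -- It turns that transposition into a conjugate, and `A` then absorbs it at the price of a second
  -- sign, which cancels the first.
  have h1 : ∀ w : Perm (Fin (k + 1)),
      A * (ρ (swap (Fin.last k).castSucc (Fin.last (k + 1))) *
        (((Perm.sign w : ℤ) : ℂ) • ρ (permCastSucc (k + 1) w))) =
      A * ρ (swap (w⁻¹ (Fin.last k)).castSucc (Fin.last (k + 1))) := by
    intro w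
    have h2 : swap (Fin.last k).castSucc (Fin.last (k + 1)) * permCastSucc (k + 1) w =
        permCastSucc (k + 1) w * swap (w⁻¹ (Fin.last k)).castSucc (Fin.last (k + 1)) := by
      rw [Equiv.mul_swap_eq_swap_mul, permCastSucc_castSucc, permCastSucc_last,
        show w (w⁻¹ (Fin.last k)) = _ from w.apply_symm_apply _]
    rw [mul_smul_comm, ← map_mul, h2, map_mul, mul_smul_comm, ← mul_assoc]
    rw [show A * ρ (permCastSucc (k + 1) w) = ((Perm.sign w : ℤ) : ℂ) • A from signSum_mul _ w,
      smul_mul_assoc, smul_smul, sign_mul_self_cast, one_smul]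
  have h3 : A * (ρ (swap (Fin.last k).castSucc (Fin.last (k + 1))) * A) =
      (k.factorial : ℂ) • ∑ j : Fin (k + 1), A * ρ (swap j.castSucc (Fin.last (k + 1))) := by
    conv_lhs => enter [2, 2]; rw [hA, signSum]
    rw [Finset.mul_sum, Finset.mul_sum]
    refine (Finset.sum_congr rfl fun w _ => h1 w).trans ?_
    rw [Nat.cast_smul_eq_nsmul,
      ← sum_perm_apply (fun j => A * ρ (swap j.castSucc (Fin.last (k + 1)))) (Fin.last k)]
    -- The conjugates involve the preimage of the letter `k`, whereas `sum_perm_apply` counts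
    -- images; inversion exchanges the two.
    exact Fintype.sum_equiv (Equiv.inv _) _ _ fun w => rfl
  rw [signSum_succ ρ, h3, smul_smul, inv_mul_cancel₀ (Nat.cast_ne_zero.2 k.factorial_ne_zero),
    one_smul]

end signedSum

/-! ### The recursion for signed sums in the Brauer category -/

namespace Brauer

variable (m : ℕ)

/-- Adding a strand on the right. -/
def addStrand (k : ℕ) : End (P m k) →* End (P m (k + 1)) where
  toFun f := (f : P m k ⟶ P m k) ▷ V m
  map_one' := id_whiskerRight _ _
  map_mul' _ _ := comp_whiskerRight _ _ _

/-- Two homomorphisms that agree on the adjacent transpositions are equal, and a crossing away from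
the last strand is by construction a smaller crossing with a strand added. -/
theorem perm_permCastSucc (k : ℕ) :
    (perm m (k + 2)).comp (permCastSucc (k + 1)) = (addStrand m (k + 1)).comp (perm m (k + 1)) := by
  refine MonoidHom.eq_of_eqOn_denseM (Equiv.Perm.mclosure_swap_castSucc_succ k) ?_
  rintro _ ⟨i, rfl⟩
  rw [MonoidHom.comp_apply, MonoidHom.comp_apply, permCastSucc_swap]
  refine (perm_swap m (k + 2) i (by omega)).trans ?_
  rw [crossAt_of_lt m i.2]
  exact congrArg (fun f : P m (k + 1) ⟶ P m (k + 1) => f ▷ V m)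
    (perm_swap m (k + 1) i (by omega)).symm

theorem signSum_permCastSucc (k : ℕ) :
    signSum (R := End (P m (k + 2))) ((perm m (k + 2)).comp (permCastSucc (k + 1))) =
      signedSum m (k + 1) ▷ V m := by
  rw [perm_permCastSucc]
  -- Adding a strand is packaged as a linear map so that it passes through the signed sum.
  let φ : (P m (k + 1) ⟶ P m (k + 1)) →ₗ[ℂ] (P m (k + 2) ⟶ P m (k + 2)) :=
    { toFun := fun f => f ▷ V m
      map_add' := fun _ _ => MonoidalPreadditive.add_whiskerRight _ _
      map_smul' := fun _ _ => MonoidalLinear.smul_whiskerRight _ _ _ }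
  refine Eq.trans ?_ (map_sum φ _ _).symm
  exact Finset.sum_congr rfl fun w _ => (map_smul φ _ _).symm

theorem signedSum_succ_succ (k : ℕ) :
    signedSum m (k + 2) = signedSum m (k + 1) ▷ V m - ((k.factorial : ℂ)⁻¹) •
      (signedSum m (k + 1) ▷ V m ≫ lastPair (P m k) (crossing m) ≫ signedSum m (k + 1) ▷ V m) := by
  have h := signSum_succ_succ (R := End (P m (k + 2))) (perm m (k + 2))
  have h1 : perm m (k + 2) (Equiv.swap (Fin.last k).castSucc (Fin.last (k + 1))) =
      lastPair (P m k) (crossing m) :=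
    (perm_swap m (k + 2) k (by omega)).trans (crossAt_last m k)
  rw [signSum_permCastSucc] at h
  refine h.trans (congrArg (fun t : P m (k + 1) ⊗ V m ⟶ P m (k + 1) ⊗ V m =>
    signedSum m (k + 1) ▷ V m - ((k.factorial : ℂ)⁻¹) • t) ?_)
  -- Multiplication in `End` is composition in the reverse order. The product is a palindrome, so
  -- after translation only the bracketing differs.
  refine (congrArg (fun t => End.of (signedSum m (k + 1) ▷ V m) *
    (t * End.of (signedSum m (k + 1) ▷ V m))) h1).trans ?_
  exact Category.assoc _ _ _

theorem signedSum_of_subsingleton {k : ℕ} (h : Subsingleton (Equiv.Perm (Fin k))) :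
    signedSum m k = 𝟙 _ := by
  rw [signedSum, Fintype.sum_subsingleton _ 1, map_one, map_one, Units.val_one,
    Int.cast_one, one_smul]
  rfl

end Brauer

/-! ### Bigons and the rotated ladder relation -/

namespace Web

variable (m : ℕ)

/-- The bigon with the thin side on the right. -/
theorem split_merge (k : ℕ) : splitR m k ≫ mergeR m k = ((k : ℂ) + 1) • 𝟙 _ := by
  -- The cap is a nondegenerate pairing, so it suffices to compare after capping. There the two
  -- vertices can be transferred to the other leg, where they form the bigon with the thin side on
  -- the left.
  refine pairing_injective (zig_reduce' (zigzagL m (k + 1))) ?_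
  rw [whiskerLeft_comp, Category.assoc, rotateR, whisker_exchange_assoc, ← rotateL',
    ← Category.assoc, ← comp_whiskerRight, bigon, MonoidalLinear.smul_whiskerRight,
    MonoidalLinear.whiskerLeft_smul, id_whiskerRight, whiskerLeft_id]

/-- A quarter turn of the ladder relation. The upper ladder turns into a merge followed by a split,
the cap followed by the cup turns into the identity, and the two lower ladders combine into one
crossing, which a quarter turn leaves unchanged. -/
theorem merge_split_succ (k : ℕ) : mergeR m (k + 1) ≫ splitR m (k + 1) =
    𝟙 _ - splitR m k ▷ S m 1 ≫ (α_ _ _ _).hom ≫ S m k ◁ crossing m ≫ (α_ _ _ _).inv ≫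
      mergeR m k ▷ S m 1 :=
  merge_split (zigzagL m 1) (zigzagR m 1) (zigzagL m k) (zigzagR m k) (zigzagL m (k + 1))
    (rotateR m k) (rotateR m (k + 1)) (rotateL' m (k + 1)) (ladder' m k) (quarter_crossing' m)

end Web

/-! ### Splitting a strand completely and merging it back -/

namespace StdWeb

variable (m : ℕ)

/-- The nested bigons collapse from the inside out: the inner ones give `k!` by induction, and the
outermost gives `k + 1`. -/
theorem splitAll_mergeAll : ∀ k : ℕ, splitAll m k ≫ mergeAll m k = (k.factorial : ℂ) • 𝟙 _
  | 0 => by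
    rw [Nat.factorial_zero, Nat.cast_one, one_smul]
    exact Category.comp_id _
  | k + 1 => by
    have h : splitAll m (k + 1) ≫ mergeAll m (k + 1) =
        Web.splitR m k ≫ (splitAll m k ≫ mergeAll m k) ▷ Web.S m 1 ≫ Web.mergeR m k := by
      rw [comp_whiskerRight, Category.assoc]
      exact Category.assoc _ _ _
    rw [h, splitAll_mergeAll k, MonoidalLinear.smul_whiskerRight, id_whiskerRight,
      Linear.smul_comp, Category.id_comp, Linear.comp_smul, Web.split_merge, smul_smul,
      Nat.factorial_succ, Nat.cast_mul, Nat.cast_succ, mul_comm]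

end StdWeb

/-! ### The recursion for merge-split webs -/

section recursion

universe v u

variable {D : Type u} [Category.{v} D] [Preadditive D] [Linear ℂ D] [MonoidalCategory D]
  [MonoidalPreadditive D] [MonoidalLinear ℂ D]

/-- In the application `M` and `N` merge and split `k` strands, `c = k!`, and `J` is the web on `k +
1` strands. Since `N ≫ M` is an invertible scalar, copies of `J` can be completed on both sides of
the crossing. -/
theorem merge_split_recursion {A V K L T : D} {M : A ⟶ K} {N : K ⟶ A} {mR : K ⊗ V ⟶ L}
    {sR : L ⟶ K ⊗ V} {mR' : L ⊗ V ⟶ T} {sR' : T ⟶ L ⊗ V} {X : V ⊗ V ⟶ V ⊗ V} {c : ℂ}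
    (hc : c ≠ 0) (hNM : N ≫ M = c • 𝟙 _)
    (h : mR' ≫ sR' = 𝟙 _ - sR ▷ V ≫ (α_ _ _ _).hom ≫ K ◁ X ≫ (α_ _ _ _).inv ≫ mR ▷ V)
    {J : A ⊗ V ⟶ A ⊗ V} (hJ : J = (M ▷ V ≫ mR) ≫ sR ≫ N ▷ V) :
    ((M ▷ V ≫ mR) ▷ V ≫ mR') ≫ sR' ≫ (sR ≫ N ▷ V) ▷ V =
      J ▷ V - c⁻¹ • (J ▷ V ≫ lastPair A X ≫ J ▷ V) := by
  -- The crossing acts on the last two strands only, so `M` slides past it and meets `N`.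
  have hX : M ▷ V ▷ V ≫ (α_ _ _ _).hom ≫ K ◁ X ≫ (α_ _ _ _).inv ≫ N ▷ V ▷ V =
      lastPair A X ≫ (M ≫ N) ▷ V ▷ V := by
    calc _ = (α_ _ _ _).hom ≫ (M ▷ (V ⊗ V) ≫ K ◁ X) ≫ (α_ _ _ _).inv ≫ N ▷ V ▷ V := by monoidal
      _ = _ := by rw [← whisker_exchange, lastPair]; monoidal
  have h1 : (M ▷ V ≫ mR) ≫ sR = c⁻¹ • (J ≫ M ▷ V) := by
    rw [hJ, Category.assoc _ _ (M ▷ V), Category.assoc sR, ← comp_whiskerRight, hNM,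
      MonoidalLinear.smul_whiskerRight, id_whiskerRight, Linear.comp_smul, Category.comp_id,
      Linear.comp_smul, smul_smul, inv_mul_cancel₀ hc, one_smul]
  -- `J` begins with `M`, so it absorbs `M ≫ N` up to the factor `c`.
  have h2 : (M ≫ N) ▷ V ≫ J = c • J := by
    rw [hJ, comp_whiskerRight M N, Category.assoc, Category.assoc,
      ← comp_whiskerRight_assoc N M, hNM,
      MonoidalLinear.smul_whiskerRight, id_whiskerRight, Linear.smul_comp, Category.id_comp,
      Linear.comp_smul]
  have h3 : mR ≫ sR ≫ N ▷ V = c⁻¹ • (N ▷ V ≫ J) := by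
    rw [hJ, Category.assoc, ← comp_whiskerRight_assoc, hNM,
      MonoidalLinear.smul_whiskerRight, id_whiskerRight, Linear.smul_comp, Category.id_comp,
      smul_smul, inv_mul_cancel₀ hc, one_smul]
  calc _ = (M ▷ V ≫ mR) ▷ V ≫ (mR' ≫ sR') ≫ (sR ≫ N ▷ V) ▷ V := by simp only [Category.assoc]
    _ = ((M ▷ V ≫ mR) ≫ sR ≫ N ▷ V) ▷ V - ((M ▷ V ≫ mR) ≫ sR) ▷ V ≫ (α_ _ _ _).hom ≫
        K ◁ X ≫ (α_ _ _ _).inv ≫ (mR ≫ sR ≫ N ▷ V) ▷ V := by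
      rw [h, Preadditive.sub_comp, Preadditive.comp_sub]
      simp only [Category.id_comp, Category.assoc, comp_whiskerRight]
    -- Each completed copy of `J` costs one factor `c⁻¹`; absorbing `M ≫ N` afterwards gives one of
    -- them back.
    _ = J ▷ V - (c⁻¹ * c⁻¹) • (J ▷ V ≫ (M ▷ V ▷ V ≫ (α_ _ _ _).hom ≫ K ◁ X ≫ (α_ _ _ _).inv ≫
        N ▷ V ▷ V) ≫ J ▷ V) := by
      rw [← hJ, h1, h3, MonoidalLinear.smul_whiskerRight, MonoidalLinear.smul_whiskerRight]
      simp only [Linear.smul_comp, Linear.comp_smul, comp_whiskerRight, Category.assoc, smul_smul]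
    _ = _ := by
      rw [hX, Category.assoc, ← comp_whiskerRight, h2, MonoidalLinear.smul_whiskerRight,
        Linear.comp_smul, Linear.comp_smul, smul_smul, mul_assoc, inv_mul_cancel₀ hc, mul_one]

end recursion

/-! ### Comparison of the two recursions through `eta` -/

namespace StdWeb

variable (m : ℕ)

/-- The functor `eta` with values in the web category. -/
abbrev toWeb : Brauer m ⥤ Web m :=
  Presented.lift (P := brauerPresentation m) (fun _ => Web.S m 1) (Web.ofBrauerGen m)
    (Web.ofBrauerGen_rel m)

instance : (toWeb m).Additive where
  map_add {_ _ f g} := by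
    induction f using Quotient.ind
    induction g using Quotient.ind
    rfl

instance : (toWeb m).Linear ℂ where
  map_smul f c := by
    induction f using Quotient.ind
    rfl

theorem toWeb_whiskerRight {X Y : Brauer m} (f : X ⟶ Y) (Z : Brauer m) :
    (toWeb m).map (f ▷ Z) = (toWeb m).map f ▷ (toWeb m).obj Z := by
  induction f using Quotient.ind
  rfl

/-- The shape of the recursion is preserved because the functor is linear and commutes strictly with
adding a strand on the right. -/
theorem toWeb_map_sub_smul {X Z : Brauer m} (f : X ⟶ X) (g : X ⊗ Z ⟶ X ⊗ Z) (c : ℂ) :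
    (toWeb m).map (f ▷ Z - c • (f ▷ Z ≫ g ≫ f ▷ Z)) =
      (toWeb m).map f ▷ (toWeb m).obj Z - c • ((toWeb m).map f ▷ (toWeb m).obj Z ≫
        (toWeb m).map g ≫ (toWeb m).map f ▷ (toWeb m).obj Z) := by
  rw [Functor.map_sub, Functor.map_smul, Functor.map_comp, Functor.map_comp, toWeb_whiskerRight]
  rfl

theorem mergeAll_splitAll_succ_succ (k : ℕ) :
    mergeAll m (k + 2) ≫ splitAll m (k + 2) =
      (mergeAll m (k + 1) ≫ splitAll m (k + 1)) ▷ Web.S m 1 - ((k.factorial : ℂ)⁻¹) •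
        ((mergeAll m (k + 1) ≫ splitAll m (k + 1)) ▷ Web.S m 1 ≫
          lastPair (P m k).obj (Web.crossing m) ≫
          (mergeAll m (k + 1) ≫ splitAll m (k + 1)) ▷ Web.S m 1) :=
  merge_split_recursion (Nat.cast_ne_zero.2 k.factorial_ne_zero) (splitAll_mergeAll m k)
    (Web.merge_split_succ m k) rfl

/-- Induction along the common recursion, which starts at two strands and therefore needs two base
cases. -/
theorem toWeb_signedSum : ∀ k : ℕ,
    (toWeb m).map (Brauer.signedSum m k) = mergeAll m k ≫ splitAll m k
  | 0 => by
    rw [Brauer.signedSum_of_subsingleton m inferInstance]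
    exact (Category.comp_id (𝟙 (𝟙_ (Web m)))).symm
  | 1 => by
    rw [Brauer.signedSum_of_subsingleton m inferInstance]
    -- A strand labelled `0` is the unit, so the first merge and split are a left unitor and its
    -- inverse.
    change 𝟙 (𝟙_ (Web m) ⊗ Web.S m 1) = (𝟙 (𝟙_ (Web m)) ▷ Web.S m 1 ≫ (λ_ (Web.S m 1)).hom) ≫
      (λ_ (Web.S m 1)).inv ≫ 𝟙 (𝟙_ (Web m)) ▷ Web.S m 1
    monoidal
  | k + 2 => by
    rw [Brauer.signedSum_succ_succ, mergeAll_splitAll_succ_succ, ← toWeb_signedSum (k + 1)]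
    -- The image of the crossing of the last two strands is, by unfolding, the same expression in
    -- the web crossing.
    exact toWeb_map_sub_smul m _ _ _

theorem eta_signedSum (k : ℕ) : (eta m).map (Brauer.signedSum m k) = mergeSplit m k :=
  ObjectProperty.hom_ext _ (toWeb_signedSum m k)

theorem eta_antisymmetrizer (k : ℕ) :
    (eta m).map (Brauer.antisymmetrizer m k) = ((k.factorial : ℂ)⁻¹) • mergeSplit m k := by
  refine ObjectProperty.hom_ext _ ?_
  refine ((toWeb m).map_smul _ _).trans ?_
  rw [toWeb_signedSum]
  rfl

/-- The web factors through the object `k`, whose identity vanishes. -/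
theorem mergeSplit_eq_zero {k : ℕ} (hk : m < k) : mergeSplit m k = 0 := by
  refine ObjectProperty.hom_ext _ ?_
  have h : 𝟙 (Web.S m k) = 0 :=
    Presented.cls_eq (P := webPresentation m) (Eqv.rel (WebRel.vanish k hk))
  change mergeAll m k ≫ splitAll m k = 0
  rw [← Category.id_comp (splitAll m k), h, Limits.zero_comp, Limits.comp_zero]

end StdWeb

end OWeb

theorem proposition5 (m : ℕ) :
    (∀ k : ℕ,
      (OWeb.eta m).map (OWeb.Brauer.signedSum m k) = OWeb.StdWeb.mergeSplit m k ∧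
      (OWeb.eta m).map (OWeb.Brauer.antisymmetrizer m k) =
        ((k.factorial : ℂ)⁻¹) • OWeb.StdWeb.mergeSplit m k) ∧
    (OWeb.eta m).map (OWeb.Brauer.antisymmetrizer m (m + 1)) = 0 := by
  refine ⟨fun k => ⟨OWeb.StdWeb.eta_signedSum m k, OWeb.StdWeb.eta_antisymmetrizer m k⟩, ?_⟩
  rw [OWeb.StdWeb.eta_antisymmetrizer, OWeb.StdWeb.mergeSplit_eq_zero m (Nat.lt_succ_self m),
    smul_zero]
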